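/- For a graph $G=(V,E)$ of bounded degree and $1\le p\le\infty$, let $S$ be the bounded operator on $\ell^p(V)$ (complex scalars) given by $(Sf)(u)=\sum_{v\sim u}f(v)$. The infinite tail is the graph with vertices $u_1,u_2,\dots$ in which $u_j\sim u_k$ if and only if $|j-k|=1$; its shift is denoted $T$. For a finite graph $H$ and a vertex $v_0$ of $H$, let $G_H$ be the graph obtained from the disjoint union of $H$ and the infinite tail by adding the edge $v_0u_1$. The essential spectrum of a bounded operator $A$ is the set of $\lambda\in\mathbb C$ such that $A-\lambda$ is not Fredholm. Let $\Lambda(H,v_0)$ be the set of all $\lambda\in\mathbb C$ such that either (a) $\lambda$ is an eigenvalue of the adjacency matrix of $H$ with an eigenvector that vanishes at $v_0$, or (b) $\lambda=b+1/b$ for some $b\in\mathbb C$ with $0<|b|<1$ for which there is $f:V(H)\to\mathbb C$ with $f(v_0)=1$, $\sum_{w\sim v_0}f(w)+b=\lambda f(v_0)$ and $\sum_{w\sim v}f(w)=\lambda f(v)$ for every vertex $v\ne v_0$ of $H$ (sums over neighbours in $H$). Let $1\le p\le\infty$. Then: 1. The spectrum and the essential spectrum of $T$ on $\ell^p$ are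 both equal to $[-2,2]$. 2. For every finite graph $H$ and every vertex $v_0$ of $H$, the essential spectrum of $S$ on $\ell^p(G_H)$ is $[-2,2]$, and the spectrum of $S$ is the union of $[-2,2]$ and the set of eigenvalues of $S$ on $\ell^p(G_H)$. If $p<\infty$, the set of eigenvalues is $\Lambda(H,v_0)$; and for all $1\le p\le\infty$ the spectrum is $[-2,2]\cup\Lambda(H,v_0)$. 3. In each of the following cases the spectrum of $S$ on $\ell^p(G_H)$ is $[-2,2]\cup\Lambda$ with the stated set $\Lambda$, and if $p<\infty$ then $\Lambda$ is the set of eigenvalues of $S$. * Kite: $H$ is the $(n+1)$-cycle, $n\ge2$, and $v_0$ is one of its vertices. If $n=2$, then $\Lambda=\{-1,\sqrt5\}$. If $n\ge3$, then $x^{n+1}+2x^2-1$ has exactly two roots in $(-1,1)$, namely one root $x_1\in(0,1)$ and one root $x_2\in(-1,0)$, and $\Lambda=\{2\cos(2\pi j/(n+1)) : 1\le j\le\lfloor n/2\rfloor\}\cup\{x_1+1/x_1,\;x_2+1/x_2\}$. * Fly-swatter: $H=K_{n+1}$, $n\ge2$, and $v_0$ is one of its vertices. Then $\Lambda=\{-1,\;b+1/b\}$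 with $b=\frac12\left(-1+\sqrt{\frac{n+3}{n-1}}\right)$. * Comb: $H$ has vertices $v_1,\dots,v_n,w_1,\dots,w_n$, $n\ge2$, and edges $v_jv_{j+1}$ ($1\le j\le n-1$) and $v_jw_j$ ($1\le j\le n$), and the tail is attached at $v_n$. Then $\Lambda=\{b+1/b : b\in\mathbb C,\ |b|<1,\ h_n(b)=0\}$, where $h_1=1$, $h_2(b)=-b^6-b^4+1$ and $h_n(b)=(b^4+b^2+1)h_{n-1}(b)-b^2(b^2+1)^2h_{n-2}(b)$ for $n\ge3$. -/

import Mathlib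

open scoped ENNReal Polynomial

noncomputable section

namespace InfiniteTail

universe u

variable {V : Type u}

/-! ### The shift operator on `ℓ^p` of a graph of bounded degree -/

/-- The shift operator on all functions: `(S f)(u) = ∑_{v ∼ u} f v`. -/
def shift (G : SimpleGraph V) [G.LocallyFinite] (f : V → ℂ) (u : V) : ℂ :=
  ∑ v ∈ G.neighborFinset u, f v

/-- The vertex degrees of `G` are bounded. -/
def HasBoundedDegree (G : SimpleGraph V) [G.LocallyFinite] : Prop :=
  ∃ D : ℕ, ∀ v, G.degree v ≤ D

theorem sum_norm_shift_rpow_le (G : SimpleGraph V) [G.LocallyFinite] {D : ℕ}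
    (hD : ∀ v, G.degree v ≤ D) {p : ℝ≥0∞} (hp : 1 ≤ p.toReal)
    (f : lp (fun _ : V => ℂ) p) (s : Finset V) :
    ∑ u ∈ s, ‖shift G f u‖ ^ p.toReal ≤ (D * ‖f‖) ^ p.toReal := by
  classical
  set r := p.toReal with hr
  have hr0 : 0 < r := by linarith
  have h1 : ∀ u ∈ s, ‖shift G f u‖ ^ r ≤
      (D : ℝ) ^ (r - 1) * ∑ v ∈ G.neighborFinset u, ‖f v‖ ^ r := by
    intro u _
    calc ‖shift G f u‖ ^ r ≤ (∑ v ∈ G.neighborFinset u, ‖f v‖) ^ r :=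
          Real.rpow_le_rpow (norm_nonneg _) (norm_sum_le _ _) hr0.le
      _ ≤ ((G.neighborFinset u).card : ℝ) ^ (r - 1) * ∑ v ∈ G.neighborFinset u, ‖f v‖ ^ r :=
          Real.rpow_sum_le_const_mul_sum_rpow_of_nonneg _ hp fun _ _ => norm_nonneg _
      _ ≤ _ := by
          refine mul_le_mul_of_nonneg_right ?_ (Finset.sum_nonneg fun _ _ => by positivity)
          refine Real.rpow_le_rpow (by positivity) ?_ (by linarith)
          rw [G.card_neighborFinset_eq_degree u]
          exact_mod_cast hD u
  set t := s.biUnion fun u => G.neighborFinset u with ht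
  have h2 : ∑ u ∈ s, ∑ v ∈ G.neighborFinset u, ‖f v‖ ^ r ≤ D * ∑ v ∈ t, ‖f v‖ ^ r := by
    have e : ∑ u ∈ s, ∑ v ∈ G.neighborFinset u, ‖f v‖ ^ r =
        ∑ v ∈ t, ∑ u ∈ s with G.Adj v u, ‖f v‖ ^ r := by
      refine Finset.sum_comm' fun u v => ?_
      simp only [SimpleGraph.mem_neighborFinset, Finset.mem_filter, ht, Finset.mem_biUnion]
      constructor
      · rintro ⟨hu, huv⟩
        exact ⟨⟨hu, huv.symm⟩, u, hu, huv⟩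
      · rintro ⟨⟨hu, hvu⟩, _⟩
        exact ⟨hu, hvu.symm⟩
    rw [e, Finset.mul_sum]
    refine Finset.sum_le_sum fun v _ => ?_
    rw [Finset.sum_const, nsmul_eq_mul]
    refine mul_le_mul_of_nonneg_right ?_ (by positivity)
    have : (s.filter fun u => G.Adj v u).card ≤ G.degree v := by
      rw [← G.card_neighborFinset_eq_degree v]
      refine Finset.card_le_card fun u hu => ?_
      simpa using (Finset.mem_filter.1 hu).2
    exact_mod_cast this.trans (hD v)
  calc ∑ u ∈ s, ‖shift G f u‖ ^ r
      ≤ ∑ u ∈ s, (D : ℝ) ^ (r - 1) * ∑ v ∈ G.neighborFinset u, ‖f v‖ ^ r := Finset.sum_le_sum h1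
    _ = (D : ℝ) ^ (r - 1) * ∑ u ∈ s, ∑ v ∈ G.neighborFinset u, ‖f v‖ ^ r := by
        rw [Finset.mul_sum]
    _ ≤ (D : ℝ) ^ (r - 1) * (D * ‖f‖ ^ r) := by
        refine mul_le_mul_of_nonneg_left (h2.trans ?_) (by positivity)
        exact mul_le_mul_of_nonneg_left (lp.sum_rpow_le_norm_rpow hr0 f t) (by positivity)
    _ = (D * ‖f‖) ^ r := by
        rw [Real.mul_rpow (by positivity) (lp.norm_nonneg' f), ← mul_assoc]
        congr 1
        rcases Nat.eq_zero_or_pos D with rfl | h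
        · simp [Real.zero_rpow hr0.ne']
        · have hD0 : (0 : ℝ) < D := by exact_mod_cast h
          rw [Real.rpow_sub_one hD0.ne']
          field_simp

theorem norm_shift_apply_le (G : SimpleGraph V) [G.LocallyFinite] {D : ℕ}
    (hD : ∀ v, G.degree v ≤ D) (f : lp (fun _ : V => ℂ) ∞) (u : V) :
    ‖shift G f u‖ ≤ D * ‖f‖ := by
  calc ‖shift G f u‖ ≤ ∑ v ∈ G.neighborFinset u, ‖f‖ :=
        norm_sum_le_of_le _ fun v _ => lp.norm_apply_le_norm ENNReal.top_ne_zero f v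
    _ = G.degree u * ‖f‖ := by
        rw [Finset.sum_const, nsmul_eq_mul, G.card_neighborFinset_eq_degree u]
    _ ≤ D * ‖f‖ := mul_le_mul_of_nonneg_right (by exact_mod_cast hD u) (norm_nonneg _)

theorem one_le_toReal {p : ℝ≥0∞} (h1 : 1 ≤ p) (hp : p ≠ ∞) : 1 ≤ p.toReal := by
  simpa using ENNReal.toReal_mono hp h1

theorem memℓp_shift (G : SimpleGraph V) [G.LocallyFinite] (hG : HasBoundedDegree G)
    (p : ℝ≥0∞) [h1 : Fact (1 ≤ p)] (f : lp (fun _ : V => ℂ) p) : Memℓp (shift G f) p := by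
  obtain ⟨D, hD⟩ := hG
  rcases eq_or_ne p ∞ with rfl | hp
  · refine memℓp_infty ⟨D * ‖f‖, ?_⟩
    rintro _ ⟨u, rfl⟩
    exact norm_shift_apply_le G hD f u
  · exact memℓp_gen' (sum_norm_shift_rpow_le G hD (one_le_toReal h1.out hp) f)

/-- The shift operator as a bounded operator on `ℓ^p(G)`, for a graph of bounded degree. -/
def shiftLp (G : SimpleGraph V) [G.LocallyFinite] (hG : HasBoundedDegree G)
    (p : ℝ≥0∞) [Fact (1 ≤ p)] :
    lp (fun _ : V => ℂ) p →L[ℂ] lp (fun _ : V => ℂ) p :=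
  LinearMap.mkContinuousOfExistsBound
    { toFun := fun f => ⟨shift G f, memℓp_shift G hG p f⟩
      map_add' := fun f g => by
        ext u
        exact Finset.sum_add_distrib
      map_smul' := fun c f => by
        ext u
        exact (Finset.mul_sum _ _ _).symm }
    (by
      have h1 : 1 ≤ p := Fact.out
      obtain ⟨D, hD⟩ := hG
      refine ⟨D, fun f => ?_⟩
      rcases eq_or_ne p ∞ with rfl | hp
      · exact lp.norm_le_of_forall_le (by positivity) (norm_shift_apply_le G hD f)
      · have h := one_le_toReal h1 hp
        exact lp.norm_le_of_forall_sum_le (by linarith) (by positivity)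
          (sum_norm_shift_rpow_le G hD h f))

theorem shiftLp_apply (G : SimpleGraph V) [G.LocallyFinite] (hG : HasBoundedDegree G)
    (p : ℝ≥0∞) [Fact (1 ≤ p)] (f : lp (fun _ : V => ℂ) p) (u : V) :
    shiftLp G hG p f u = ∑ v ∈ G.neighborFinset u, f v := rfl

/-! ### Parts of the spectrum -/

section Spectra

variable {E : Type*} [NormedAddCommGroup E] [NormedSpace ℂ E]

/-- The set of eigenvalues of a bounded operator. -/
def pointSpectrum (A : E →L[ℂ] E) : Set ℂ :=
  {z | Module.End.HasEigenvalue (A : E →ₗ[ℂ] E) z}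

/-- The essential spectrum: the `z` such that `A - z` is not a Fredholm operator. -/
def essentialSpectrum (A : E →L[ℂ] E) : Set ℂ :=
  {z | ¬ (A - z • ContinuousLinearMap.id ℂ E).IsFredholm}

end Spectra

/-- The real interval `[-2, 2]`, as a subset of `ℂ`. -/
def band : Set ℂ := ((↑) : ℝ → ℂ) '' Set.Icc (-2) 2

/-! ### The infinite tail, and a finite graph with an infinite tail -/

/-- The infinite tail: `j ∼ k` if and only if `|j - k| = 1`. The number `k` stands for `u_{k+1}`. -/
def tail : SimpleGraph ℕ where
  Adj j k := j + 1 = k ∨ k + 1 = j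
  symm := ⟨fun _ _ h => h.symm⟩
  loopless := ⟨fun k h => by omega⟩

/-- The adjacency relation of `H` with an infinite tail: `Sum.inl v` is the vertex `v` of `H`, and
`Sum.inr k` is the vertex `u_{k+1}` of the tail. The only edge between them joins `v₀` and `u_1`. -/
def attachTailAdj (H : SimpleGraph V) (v₀ : V) : V ⊕ ℕ → V ⊕ ℕ → Prop
  | Sum.inl a, Sum.inl b => H.Adj a b
  | Sum.inl a, Sum.inr k => a = v₀ ∧ k = 0
  | Sum.inr k, Sum.inl a => a = v₀ ∧ k = 0
  | Sum.inr j, Sum.inr k => tail.Adj j k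

/-- The graph obtained from `H` by attaching an infinite tail to the vertex `v₀`. -/
def attachTail (H : SimpleGraph V) (v₀ : V) : SimpleGraph (V ⊕ ℕ) where
  Adj := attachTailAdj H v₀
  symm := ⟨by
    rintro (a | j) (b | k) h
    · exact SimpleGraph.Adj.symm (G := H) h
    · exact h
    · exact h
    · exact SimpleGraph.Adj.symm (G := tail) h⟩
  loopless := ⟨by
    rintro (a | j) h
    · exact H.irrefl h
    · exact tail.irrefl h⟩

theorem tail_neighborSet_subset (k : ℕ) :
    tail.neighborSet k ⊆ (({k - 1, k + 1} : Finset ℕ) : Set ℕ) := by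
  intro j hj
  have hj' : k + 1 = j ∨ j + 1 = k := hj
  simp only [Finset.coe_insert, Finset.coe_singleton, Set.mem_insert_iff, Set.mem_singleton_iff]
  omega

instance tailLocallyFinite : tail.LocallyFinite := fun k =>
  ((Finset.finite_toSet _).subset (tail_neighborSet_subset k)).fintype

theorem tail_hasBoundedDegree : HasBoundedDegree tail := by
  refine ⟨2, fun k => ?_⟩
  rw [← tail.card_neighborFinset_eq_degree k]
  refine (Finset.card_le_card (t := {k - 1, k + 1}) fun j hj => ?_).trans Finset.card_le_two
  exact_mod_cast tail_neighborSet_subset k (by simpa using hj)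

open Classical in
theorem attachTail_neighborSet_subset [Fintype V] (H : SimpleGraph V) (v₀ : V) (x : V ⊕ ℕ) :
    (attachTail H v₀).neighborSet x ⊆
      ((Finset.univ.image Sum.inl ∪ {Sum.inr 0, Sum.inr (x.elim (fun _ => 0) id - 1),
        Sum.inr (x.elim (fun _ => 0) id + 1)} : Finset (V ⊕ ℕ)) : Set (V ⊕ ℕ)) := by
  intro y hy
  have hy' : attachTailAdj H v₀ x y := hy
  rcases y with b | k
  · simp
  · rcases x with a | j
    · have : k = 0 := hy'.2
      simp [this]
    · have : j + 1 = k ∨ k + 1 = j := hy'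
      simp
      omega

instance attachTailLocallyFinite [Fintype V] (H : SimpleGraph V) (v₀ : V) :
    (attachTail H v₀).LocallyFinite := fun x =>
  ((Finset.finite_toSet _).subset (attachTail_neighborSet_subset H v₀ x)).fintype

theorem attachTail_hasBoundedDegree [Fintype V] (H : SimpleGraph V) (v₀ : V) :
    HasBoundedDegree (attachTail H v₀) := by
  classical
  refine ⟨Fintype.card V + 3, fun x => ?_⟩
  rw [← (attachTail H v₀).card_neighborFinset_eq_degree x]
  refine (Finset.card_le_card (t := Finset.univ.image Sum.inl ∪ {Sum.inr 0,
    Sum.inr (x.elim (fun _ => 0) id - 1), Sum.inr (x.elim (fun _ => 0) id + 1)}) fun y hy => ?_).trans ?_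
  · have h := attachTail_neighborSet_subset H v₀ x (by simpa using hy)
    convert Finset.mem_coe.1 h
  · exact (Finset.card_union_le _ _).trans
      (add_le_add (Finset.card_image_le.trans le_rfl) Finset.card_le_three)

/-- The shift `T` of the infinite tail on `ℓ^p`. -/
def tailShift (p : ℝ≥0∞) [Fact (1 ≤ p)] :
    lp (fun _ : ℕ => ℂ) p →L[ℂ] lp (fun _ : ℕ => ℂ) p :=
  shiftLp tail tail_hasBoundedDegree p

/-- The shift `S` on `ℓ^p` of the finite graph `H` with an infinite tail attached at `v₀`. -/
def attachTailShift [Fintype V] (H : SimpleGraph V) (v₀ : V) (p : ℝ≥0∞) [Fact (1 ≤ p)] :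
    lp (fun _ : V ⊕ ℕ => ℂ) p →L[ℂ] lp (fun _ : V ⊕ ℕ => ℂ) p :=
  shiftLp (attachTail H v₀) (attachTail_hasBoundedDegree H v₀) p

/-- The numbers given by the two finite systems of equations on `H`: the eigenvalues of the
adjacency matrix of `H` that have an eigenvector vanishing at `v₀`; and the `b + 1/b` with
`0 < |b| < 1` for which the eigenvalue equations at the vertices of `H` are solvable with
`f(v₀) = 1` and the value `b` at the first vertex of the tail. -/
def finiteSystemEigenvalues (H : SimpleGraph V) [H.LocallyFinite] (v₀ : V) : Set ℂ :=
  {z | ∃ f : V → ℂ, f ≠ 0 ∧ f v₀ = 0 ∧ ∀ v, shift H f v = z * f v} ∪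
  {z | ∃ b : ℂ, b ≠ 0 ∧ ‖b‖ < 1 ∧ z = b + 1 / b ∧ ∃ f : V → ℂ, f v₀ = 1 ∧
    shift H f v₀ + b = z * f v₀ ∧ ∀ v, v ≠ v₀ → shift H f v = z * f v}

/-! ### The three families of examples -/

/-- The kite: the `(n+1)`-cycle with an infinite tail. -/
def kiteShift (n : ℕ) (p : ℝ≥0∞) [Fact (1 ≤ p)] :
    lp (fun _ : Fin (n + 1) ⊕ ℕ => ℂ) p →L[ℂ] lp (fun _ : Fin (n + 1) ⊕ ℕ => ℂ) p :=
  attachTailShift (SimpleGraph.cycleGraph (n + 1)) 0 p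

/-- The fly-swatter: the complete graph on `n + 1` vertices with an infinite tail. -/
def flySwatterShift (n : ℕ) (p : ℝ≥0∞) [Fact (1 ≤ p)] :
    lp (fun _ : Fin (n + 1) ⊕ ℕ => ℂ) p →L[ℂ] lp (fun _ : Fin (n + 1) ⊕ ℕ => ℂ) p :=
  attachTailShift (⊤ : SimpleGraph (Fin (n + 1))) 0 p

/-- The adjacency relation of the finite comb: `Sum.inl j` is `v_{j+1}` and `Sum.inr j` is
`w_{j+1}`. -/
def combAdj (n : ℕ) : Fin n ⊕ Fin n → Fin n ⊕ Fin n → Prop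
  | Sum.inl i, Sum.inl j => (i : ℕ) + 1 = j ∨ (j : ℕ) + 1 = i
  | Sum.inl i, Sum.inr j => i = j
  | Sum.inr i, Sum.inl j => i = j
  | Sum.inr _, Sum.inr _ => False

/-- The finite comb: a path `v_1, …, v_n` with a pendant vertex `w_j` at each `v_j`. -/
def comb (n : ℕ) : SimpleGraph (Fin n ⊕ Fin n) where
  Adj := combAdj n
  symm := ⟨by
    rintro (i | i) (j | j) h
    · exact Or.symm h
    · exact Eq.symm h
    · exact Eq.symm h
    · exact h⟩
  loopless := ⟨by
    rintro (i | i) h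
    · have h' : (i : ℕ) + 1 = i ∨ (i : ℕ) + 1 = i := h
      omega
    · exact h⟩

/-- The comb with an infinite tail attached at the last vertex `v_n`. -/
def combShift (n : ℕ) (hn : 2 ≤ n) (p : ℝ≥0∞) [Fact (1 ≤ p)] :
    lp (fun _ : (Fin n ⊕ Fin n) ⊕ ℕ => ℂ) p →L[ℂ] lp (fun _ : (Fin n ⊕ Fin n) ⊕ ℕ => ℂ) p :=
  attachTailShift (comb n) (Sum.inl ⟨n - 1, by omega⟩) p

/-- The eigenvalues `2 cos (2πj/(n+1))`, `1 ≤ j ≤ ⌊n/2⌋`, of the kite. -/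
def kiteCosines (n : ℕ) : Set ℂ :=
  {z | ∃ j : ℕ, 1 ≤ j ∧ j ≤ n / 2 ∧ z = ((2 * Real.cos (2 * Real.pi * j / (n + 1)) : ℝ) : ℂ)}

/-- The positive root `b` of `(n-1) b² + (n-1) b - 1`. -/
def flySwatterRoot (n : ℕ) : ℝ :=
  (-1 + Real.sqrt (((n : ℝ) + 3) / ((n : ℝ) - 1))) / 2

/-- The polynomials `h_n` of the comb, for `n ≥ 1`; the value at `0` plays no role. -/
def combPoly : ℕ → ℂ[X]
  | 0 => 1
  | 1 => 1
  | 2 => -Polynomial.X ^ 6 - Polynomial.X ^ 4 + 1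
  | n + 3 => (Polynomial.X ^ 4 + Polynomial.X ^ 2 + 1) * combPoly (n + 2) -
      Polynomial.X ^ 2 * (Polynomial.X ^ 2 + 1) ^ 2 * combPoly (n + 1)

/-- The numbers `b + 1/b`, for the roots `b` of `h_n` of modulus less than one. -/
def combEigenvalues (n : ℕ) : Set ℂ :=
  {z | ∃ b : ℂ, ‖b‖ < 1 ∧ (combPoly n).eval b = 0 ∧ z = b + 1 / b}

end InfiniteTail

end

/-!
On `ℓ^p(ℕ)` the shift of the tail is `T = L + R` with `L` and `R` the left and right shifts. Since
`L R = 1`, it satisfies `T - (b + b⁻¹) = -b⁻¹ (1 - b L) (1 - b R)`, and every complex number is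
`b + b⁻¹` with `0 < |b| ≤ 1`. If `|b| < 1`, both factors are invertible. If `|b| = 1`, that is, on
`[-2, 2]`, the factor `1 - b R` is injective but not bounded below, which is impossible for the
right factor of a Fredholm operator.

Up to operators of finite rank, `S - λ` on `ℓ^p(G_H)` is `T - λ` conjugated by restriction to the
tail and extension by zero. Hence the essential spectra agree, and off `[-2, 2]` the operator
`S - λ` is a finite-rank perturbation of an invertible one, so it is invertible as soon as it is
injective. An eigenfunction for `λ = b + b⁻¹` that is in `ℓ^p` on the tail is a multiple of `b ^ k`
there, which leaves the finite system on `H`.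

On the cycle the solutions are combinations of `b ^ k` and `b ^ (-k)`; on the complete graph they
are constant off `v₀`, except for the eigenvalue `-1`. On the comb the pendant vertices are
eliminated by `f(w_j) = f(v_j) / λ`, and what remains is the Chebyshev recursion with parameter
`λ - 1 / λ`.
-/

noncomputable section

namespace InfiniteTail

open Filter Topology

/-! ### Fredholm operators and finite-rank perturbations -/

section Fredholm

open LinearMap.FiniteRangeSetoid

variable {𝕜 E F G : Type*} [NontriviallyNormedField 𝕜]
  [NormedAddCommGroup E] [NormedSpace 𝕜 E] [NormedAddCommGroup F] [NormedSpace 𝕜 F]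
  [NormedAddCommGroup G] [NormedSpace 𝕜 G]

theorem isCompactOperator_of_hasFiniteRange [ProperSpace 𝕜] {K : E →L[𝕜] F}
    (hK : (K : E →ₗ[𝕜] F).HasFiniteRange) : IsCompactOperator K := by
  have : FiniteDimensional 𝕜 K.range := Module.Finite.of_fg hK
  have hid : IsCompactOperator (id : K.range → K.range) :=
    (isCompactOperator_id_iff_finiteDimensional (𝕜 := 𝕜)).2 this
  exact (hid.comp_clm (K.codRestrict K.range fun x => ⟨x, rfl⟩)).clm_comp K.range.subtypeL

theorem isUnit_of_injective_of_hasFiniteRange_sub [ProperSpace 𝕜] [CompleteSpace E]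
    {A B : E →L[𝕜] E} (hB : IsUnit B) (hAB : (A - B).HasFiniteRange)
    (hA : Function.Injective A) : IsUnit A := by
  obtain ⟨u, rfl⟩ := hB
  set K : E →L[𝕜] E := (↑u⁻¹ : E →L[𝕜] E) * ((u : E →L[𝕜] E) - A) with hK
  have hAK : A = u * (1 - K) := by
    rw [hK, mul_sub, mul_one, Units.mul_inv_cancel_left, sub_sub_cancel]
  have hKc : IsCompactOperator K := by
    rw [← neg_sub, mul_neg] at hK
    rw [hK]
    exact (isCompactOperator_of_hasFiniteRange (K := (↑u⁻¹ : E →L[𝕜] E) * (A - (u : E →L[𝕜] E)))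
      (hAB.comp_left ((↑u⁻¹ : E →L[𝕜] E) : E →ₗ[𝕜] E))).neg
  have hK1 : ¬ Module.End.HasEigenvalue (K : E →ₗ[𝕜] E) 1 := by
    intro h
    obtain ⟨x, hx⟩ := h.exists_hasEigenvector
    have hKx : K x = x := by simpa using hx.apply_eq_smul
    refine hx.2 (hA ?_)
    rw [hAK, map_zero]
    simp [hKx]
  have hunit := (hKc.hasEigenvalue_or_mem_resolventSet one_ne_zero).resolve_left hK1
  rw [spectrum.mem_resolventSet_iff, map_one] at hunit
  rw [hAK]
  exact u.isUnit.mul hunit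

theorem exists_subseq_tendsto_of_isFredholm [ProperSpace 𝕜] {A : E →L[𝕜] F}
    (hA : A.IsFredholm) {x : ℕ → E} {C : ℝ} (hx : ∀ n, ‖x n‖ ≤ C)
    (hAx : Tendsto (fun n => A (x n)) atTop (𝓝 0)) :
    ∃ a, ∃ φ : ℕ → ℕ, StrictMono φ ∧ Tendsto (x ∘ φ) atTop (𝓝 a) := by
  obtain ⟨Q, hQ, -⟩ := hA.exists_isQuasiInverse
  set D : E →L[𝕜] E := Q ∘L A - ContinuousLinearMap.id 𝕜 E with hD
  have hDc : IsCompactOperator D :=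
    isCompactOperator_of_hasFiniteRange (equiv_iff_hasFiniteRange.1 hQ)
  obtain ⟨d, -, φ, hφ, hd⟩ :=
    (hDc.isCompact_closure_image_closedBall (f := (D : E →ₗ[𝕜] E)) C).tendsto_subseq
      (x := fun n => D (x n)) fun n => subset_closure ⟨x n, by simpa using hx n, rfl⟩
  have hQAx : Tendsto (fun n => Q (A (x (φ n)))) atTop (𝓝 0) :=
    (Q.continuous.tendsto' 0 0 (map_zero Q)).comp (hAx.comp hφ.tendsto_atTop)
  refine ⟨0 - d, φ, hφ, (hQAx.sub hd).congr fun n => ?_⟩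
  simp [hD]

theorem exists_norm_le_mul_of_isFredholm_comp {𝕜 E F G : Type*} [RCLike 𝕜]
    [NormedAddCommGroup E] [NormedSpace 𝕜 E] [NormedAddCommGroup F] [NormedSpace 𝕜 F]
    [NormedAddCommGroup G] [NormedSpace 𝕜 G] {B : F →L[𝕜] G} {A : E →L[𝕜] F}
    (hBA : (B ∘L A).IsFredholm) (hA : Function.Injective A) :
    ∃ C, 0 ≤ C ∧ ∀ x, ‖x‖ ≤ C * ‖A x‖ := by
  by_contra! h
  choose y hy using fun n : ℕ => h n n.cast_nonneg
  have hy0 : ∀ n, ‖y n‖ ≠ 0 := fun n => ((by positivity : 0 ≤ n * ‖A (y n)‖).trans_lt (hy n)).ne'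
  set x : ℕ → E := fun n => (‖y n‖⁻¹ : 𝕜) • y n with hx
  have hx1 : ∀ n, ‖x n‖ = 1 := fun n => by simp [hx, norm_smul, hy0 n]
  have hAx : Tendsto (fun n => A (x n)) atTop (𝓝 0) := by
    refine squeeze_zero_norm' ?_ tendsto_inv_atTop_nhds_zero_nat
    filter_upwards [eventually_gt_atTop 0] with n hn
    have hn' : (0 : ℝ) < n := Nat.cast_pos.2 hn
    calc ‖A (x n)‖ = ‖A (y n)‖ / ‖y n‖ := by simp [hx, norm_smul, div_eq_inv_mul]
      _ ≤ (n : ℝ)⁻¹ := by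
        rw [div_le_iff₀ ((norm_nonneg _).lt_of_ne' (hy0 n)), inv_mul_eq_div, le_div_iff₀' hn']
        exact (hy n).le
  obtain ⟨a, φ, hφ, ha⟩ := exists_subseq_tendsto_of_isFredholm hBA (fun n => (hx1 n).le)
    ((B.continuous.tendsto' 0 0 (map_zero B)).comp hAx)
  have ha1 : ‖a‖ = 1 := tendsto_nhds_unique ha.norm (by simp [hx1])
  have ha0 : A a = A 0 := by
    rw [map_zero]
    exact tendsto_nhds_unique ((A.continuous.tendsto a).comp ha) (hAx.comp hφ.tendsto_atTop)
  rw [hA ha0, norm_zero] at ha1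
  exact zero_ne_one ha1

theorem isLeftQuasiInverse_of_comp_eq_id {P : E →L[𝕜] F} {J : F →L[𝕜] E}
    (hPJ : P ∘L J = .id 𝕜 F) : (P : E →ₗ[𝕜] F).IsLeftQuasiInverse J := by
  have h : (P : E →ₗ[𝕜] F) ∘ₗ J = .id := congrArg ContinuousLinearMap.toLinearMap hPJ
  rw [LinearMap.IsLeftQuasiInverse, h]

variable [CompleteSpace 𝕜]

theorem isFredholm_of_isUnit {A : E →L[𝕜] E} (hA : IsUnit A) : A.IsFredholm := by
  obtain ⟨u, rfl⟩ := hA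
  have hinv : ((↑u⁻¹ : E →L[𝕜] E) : E →ₗ[𝕜] E).IsQuasiInverse (u : E →L[𝕜] E) := by
    constructor
    · exact isLeftQuasiInverse_of_comp_eq_id u.inv_mul
    · exact (isLeftQuasiInverse_of_comp_eq_id u.mul_inv).isRightQuasiInverse
  exact .of_isQuasiInverse hinv

theorem isFredholm_comp {B : F →L[𝕜] G} {A : E →L[𝕜] F} (hB : B.IsFredholm)
    (hA : A.IsFredholm) : (B ∘L A).IsFredholm := by
  obtain ⟨Q, hQ⟩ := hA.exists_isQuasiInverse
  obtain ⟨R, hR⟩ := hB.exists_isQuasiInverse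
  exact .of_isQuasiInverse (v := Q ∘L R) (LinearMap.IsQuasiInverse.comp (hu := hQ) (hv := hR))

theorem isFredholm_congr {A B : E →L[𝕜] F} (hAB : (A - B).HasFiniteRange) :
    A.IsFredholm ↔ B.IsFredholm := by
  simp only [ContinuousLinearMap.isFredholm_iff_exists_isQuasiInverse]
  exact exists_congr fun Q =>
    LinearMap.isQuasiInverse_congr (Setoid.refl (Q : F →ₗ[𝕜] E))
      (Setoid.symm (equiv_iff_hasFiniteRange.2 hAB))

end Fredholm

section Compression

open LinearMap.FiniteRangeSetoid

variable {𝕜 E F : Type*} [NontriviallyNormedField 𝕜]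
  [NormedAddCommGroup E] [NormedSpace 𝕜 E] [NormedAddCommGroup F] [NormedSpace 𝕜 F]
  {J : F →L[𝕜] E} {P : E →L[𝕜] F} {A : E →L[𝕜] E} {B : F →L[𝕜] F}

theorem isUnit_comp_comp_add_id_sub (hPJ : P ∘L J = .id 𝕜 F) (hB : IsUnit B) :
    IsUnit (J ∘L B ∘L P + (.id 𝕜 E - J ∘L P)) := by
  obtain ⟨u, rfl⟩ := hB
  have hPJ' : ∀ y, P (J y) = y := DFunLike.congr_fun hPJ
  have hmul : ∀ v w : (F →L[𝕜] F)ˣ, v * w = 1 →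
      (J ∘L (v : F →L[𝕜] F) ∘L P + (.id 𝕜 E - J ∘L P)) *
        (J ∘L (w : F →L[𝕜] F) ∘L P + (.id 𝕜 E - J ∘L P)) = 1 := by
    intro v w hvw
    have hvw' : ∀ y, (v : F →L[𝕜] F) ((w : F →L[𝕜] F) y) = y :=
      DFunLike.congr_fun (congrArg Units.val hvw)
    ext x
    simp [hPJ', hvw']
  exact isUnit_iff_exists.2 ⟨_, hmul u u⁻¹ (mul_inv_cancel u), hmul u⁻¹ u (inv_mul_cancel u)⟩

theorem isUnit_of_injective_of_hasFiniteRange_sub_comp [ProperSpace 𝕜] [CompleteSpace E]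
    (hPJ : P ∘L J = .id 𝕜 F) (hJP : (.id 𝕜 E - J ∘L P).HasFiniteRange)
    (hAB : (A - J ∘L B ∘L P).HasFiniteRange) (hB : IsUnit B) (hA : Function.Injective A) :
    IsUnit A := by
  refine isUnit_of_injective_of_hasFiniteRange_sub (isUnit_comp_comp_add_id_sub hPJ hB) ?_ hA
  rw [← sub_sub]
  exact hAB.sub hJP

theorem isFredholm_iff_of_hasFiniteRange_sub_comp [CompleteSpace 𝕜]
    (hPJ : P ∘L J = .id 𝕜 F) (hJP : (.id 𝕜 E - J ∘L P).HasFiniteRange)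
    (hAB : (A - J ∘L B ∘L P).HasFiniteRange) : A.IsFredholm ↔ B.IsFredholm := by
  have hP : (P : E →ₗ[𝕜] F).IsQuasiInverse J :=
    ⟨isLeftQuasiInverse_of_comp_eq_id hPJ,
      Setoid.symm (equiv_iff_hasFiniteRange.2 hJP)⟩
  have hJF : J.IsFredholm := .of_isQuasiInverse hP
  have hPF : P.IsFredholm := .of_isQuasiInverse hP.symm
  refine ⟨fun hA => ?_, fun hB => (isFredholm_congr hAB).2
    (isFredholm_comp hJF (isFredholm_comp hB hPF))⟩
  have hPJ' : ∀ y, P (J y) = y := DFunLike.congr_fun hPJ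
  have hPAJ : P ∘L A ∘L J - B = P ∘L (A - J ∘L B ∘L P) ∘L J := by
    ext y
    simp [hPJ']
  refine (isFredholm_congr (A := P ∘L A ∘L J) ?_).1 (isFredholm_comp hPF (isFredholm_comp hA hJF))
  rw [hPAJ]
  exact (hAB.comp_right (J : F →ₗ[𝕜] E)).comp_left (P : E →ₗ[𝕜] F)

end Compression

section Spectrum

variable {E : Type*} [NormedAddCommGroup E] [NormedSpace ℂ E] {A : E →L[ℂ] E} {z : ℂ}

theorem notMem_spectrum_iff : z ∉ spectrum ℂ A ↔ IsUnit (A - z • ContinuousLinearMap.id ℂ E) := by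
  rw [spectrum.notMem_iff, Algebra.algebraMap_eq_smul_one, ← IsUnit.neg_iff, neg_sub]
  rfl

theorem essentialSpectrum_subset_spectrum (A : E →L[ℂ] E) :
    essentialSpectrum A ⊆ spectrum ℂ A :=
  fun _ hz => by_contra fun h => hz (isFredholm_of_isUnit (notMem_spectrum_iff.1 h))

theorem mem_pointSpectrum_iff : z ∈ pointSpectrum A ↔ ∃ x, x ≠ 0 ∧ A x = z • x := by
  constructor
  · intro h
    obtain ⟨x, hx⟩ := Module.End.HasEigenvalue.exists_hasEigenvector h
    exact ⟨x, hx.2, hx.apply_eq_smul⟩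
  · rintro ⟨x, hx, hAx⟩
    exact Module.End.hasEigenvalue_of_hasEigenvector
      (Module.End.hasEigenvector_iff.2 ⟨Module.End.mem_eigenspace_iff.2 hAx, hx⟩)

theorem injective_sub_of_notMem_pointSpectrum (hz : z ∉ pointSpectrum A) :
    Function.Injective (A - z • ContinuousLinearMap.id ℂ E) := by
  refine (injective_iff_map_eq_zero _).2 fun x hx => by_contra fun hx0 => hz ?_
  exact mem_pointSpectrum_iff.2 ⟨x, hx0, sub_eq_zero.1 (by simpa using hx)⟩

theorem pointSpectrum_subset_spectrum (A : E →L[ℂ] E) : pointSpectrum A ⊆ spectrum ℂ A := by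
  intro z hz
  by_contra h
  obtain ⟨x, hx, hAx⟩ := mem_pointSpectrum_iff.1 hz
  have hinj : Function.Injective (A - z • ContinuousLinearMap.id ℂ E) :=
    ((Module.End.isUnit_iff _).1
      ((notMem_spectrum_iff.1 h).map ContinuousLinearMap.toLinearMapRingHom)).injective
  exact hx (hinj (by simp [hAx]))

end Spectrum

/-! ### Restriction and extension by zero on `ℓ^p` -/

section RestrictExtend

variable {α β 𝕜 E : Type*} [NormedAddCommGroup E] {e : α → β}

theorem norm_extend_zero_rpow {r : ℝ} (hr : 0 < r) (e : α → β) (f : α → E) (b : β) :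
    ‖Function.extend e f 0 b‖ ^ r = Function.extend e (fun a => ‖f a‖ ^ r) 0 b := by
  classical
  by_cases h : ∃ a, e a = b <;> simp [Function.extend_def, h, Real.zero_rpow hr.ne']

theorem memℓp_comp_injective {p : ℝ≥0∞} (he : Function.Injective e) {f : β → E}
    (hf : Memℓp f p) : Memℓp (f ∘ e) p := by
  rcases p.trichotomy with rfl | rfl | hp
  · exact memℓp_zero ((memℓp_zero_iff.1 hf).preimage he.injOn)
  · exact memℓp_infty ((memℓp_infty_iff.1 hf).mono (Set.range_comp_subset_range e fun b => ‖f b‖))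
  · exact (memℓp_gen_iff hp).2 (((memℓp_gen_iff hp).1 hf).comp_injective he)

theorem memℓp_extend_zero {p : ℝ≥0∞} (he : Function.Injective e) {f : α → E}
    (hf : Memℓp f p) : Memℓp (Function.extend e f 0) p := by
  rcases p.trichotomy with rfl | rfl | hp
  · refine memℓp_zero (((memℓp_zero_iff.1 hf).image e).subset fun b hb => ?_)
    by_cases h : ∃ a, e a = b
    · obtain ⟨a, rfl⟩ := h
      exact ⟨a, by simpa [he.extend_apply] using hb, rfl⟩
    · exact absurd (Function.extend_apply' f (0 : β → E) b h) hb
  · obtain ⟨C, hC⟩ := memℓp_infty_iff.1 hf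
    refine memℓp_infty ⟨max C 0, ?_⟩
    rintro _ ⟨b, rfl⟩
    by_cases h : ∃ a, e a = b
    · obtain ⟨a, rfl⟩ := h
      simpa only [he.extend_apply] using (hC ⟨a, rfl⟩).trans (le_max_left C 0)
    · simp [Function.extend_apply' f (0 : β → E) b h]
  · refine memℓp_gen ?_
    simp only [norm_extend_zero_rpow hp]
    exact ((hasSum_extend_zero he).2 ((memℓp_gen_iff hp).1 hf).hasSum).summable

variable (𝕜 E) [NontriviallyNormedField 𝕜] [NormedSpace 𝕜 E] (p : ℝ≥0∞) [Fact (1 ≤ p)]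

/-- The composition `f ↦ f ∘ e` with an injective map, as a contraction of `ℓ^p`. -/
def restrictLp (he : Function.Injective e) :
    lp (fun _ : β => E) p →L[𝕜] lp (fun _ : α => E) p :=
  LinearMap.mkContinuous
    { toFun f := ⟨f ∘ e, memℓp_comp_injective he (lp.memℓp f)⟩
      map_add' _ _ := rfl
      map_smul' _ _ := rfl }
    1 fun f => by
      rw [one_mul]
      rcases eq_or_ne p ∞ with rfl | hp
      · exact lp.norm_le_of_forall_le (norm_nonneg f) fun a =>
          lp.norm_apply_le_norm ENNReal.top_ne_zero f (e a)
      · have hp0 : 0 < p.toReal := one_pos.trans_le (one_le_toReal Fact.out hp)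
        refine lp.norm_le_of_forall_sum_le hp0 (norm_nonneg f) fun s => ?_
        have h := lp.sum_rpow_le_norm_rpow hp0 f (s.map ⟨e, he⟩)
        rwa [Finset.sum_map] at h

/-- The extension by zero along an injective map, as a contraction of `ℓ^p`. -/
def extendLp (he : Function.Injective e) :
    lp (fun _ : α => E) p →L[𝕜] lp (fun _ : β => E) p :=
  LinearMap.mkContinuous
    { toFun f := ⟨Function.extend e f 0, memℓp_extend_zero he (lp.memℓp f)⟩
      map_add' f g := by
        ext b
        have h := Function.extend_add e f g 0 0
        rw [add_zero] at h
        exact congrFun h b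
      map_smul' c f := by
        ext b
        have h := Function.extend_smul c e f 0
        rw [smul_zero] at h
        exact congrFun h b }
    1 fun f => by
      rw [one_mul]
      rcases eq_or_ne p ∞ with rfl | hp
      · refine lp.norm_le_of_forall_le (norm_nonneg f) fun b => ?_
        change ‖Function.extend e f 0 b‖ ≤ ‖f‖
        by_cases h : ∃ a, e a = b
        · obtain ⟨a, rfl⟩ := h
          simpa only [he.extend_apply] using lp.norm_apply_le_norm ENNReal.top_ne_zero f a
        · simp [Function.extend_apply' _ _ _ h]
      · have hp0 : 0 < p.toReal := one_pos.trans_le (one_le_toReal Fact.out hp)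
        have h := (hasSum_extend_zero he).2 (lp.hasSum_norm hp0 f)
        exact lp.norm_le_of_tsum_le hp0 (norm_nonneg f)
          ((tsum_congr fun b => norm_extend_zero_rpow hp0 e f b).trans h.tsum_eq).le

variable {𝕜 E p} (he : Function.Injective e)

@[simp]
theorem extendLp_apply_self (f : lp (fun _ : α => E) p) (a : α) :
    extendLp 𝕜 E p he f (e a) = f a :=
  he.extend_apply f 0 a

theorem extendLp_apply_of_notMem (f : lp (fun _ : α => E) p) {b : β} (hb : b ∉ Set.range e) :
    extendLp 𝕜 E p he f b = 0 :=
  Function.extend_apply' (f : α → E) (0 : β → E) b hb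

theorem restrictLp_comp_extendLp :
    restrictLp 𝕜 E p he ∘L extendLp 𝕜 E p he = .id 𝕜 (lp (fun _ : α => E) p) := by
  ext f a
  exact extendLp_apply_self (𝕜 := 𝕜) he f a

theorem norm_restrictLp_le : ‖restrictLp 𝕜 E p he‖ ≤ 1 :=
  LinearMap.mkContinuous_norm_le _ zero_le_one _

theorem norm_extendLp_le : ‖extendLp 𝕜 E p he‖ ≤ 1 :=
  LinearMap.mkContinuous_norm_le _ zero_le_one _

end RestrictExtend

/-! ### The shift of the tail -/

section Tail

variable (p : ℝ≥0∞) [Fact (1 ≤ p)]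

/-- The left shift `(L f)(k) = f (k + 1)` on `ℓ^p(ℕ)`. -/
def leftShift : lp (fun _ : ℕ => ℂ) p →L[ℂ] lp (fun _ : ℕ => ℂ) p :=
  restrictLp ℂ ℂ p Nat.succ_injective

/-- The right shift on `ℓ^p(ℕ)`: `(R f)(0) = 0` and `(R f)(k + 1) = f k`. -/
def rightShift : lp (fun _ : ℕ => ℂ) p →L[ℂ] lp (fun _ : ℕ => ℂ) p :=
  extendLp ℂ ℂ p Nat.succ_injective

variable {p}

@[simp]
theorem leftShift_apply (f : lp (fun _ : ℕ => ℂ) p) (k : ℕ) : leftShift p f k = f (k + 1) := rfl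

@[simp]
theorem rightShift_apply_zero (f : lp (fun _ : ℕ => ℂ) p) : rightShift p f 0 = 0 :=
  extendLp_apply_of_notMem _ f (by simp)

@[simp]
theorem rightShift_apply_succ (f : lp (fun _ : ℕ => ℂ) p) (k : ℕ) :
    rightShift p f (k + 1) = f k :=
  extendLp_apply_self Nat.succ_injective f k

theorem leftShift_mul_rightShift : leftShift p * rightShift p = 1 :=
  restrictLp_comp_extendLp Nat.succ_injective

theorem shift_tail_zero (f : ℕ → ℂ) : shift tail f 0 = f 1 := by
  have h : tail.neighborFinset 0 = {1} := by
    ext j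
    rw [SimpleGraph.mem_neighborFinset, Finset.mem_singleton]
    change 0 + 1 = j ∨ j + 1 = 0 ↔ _
    omega
  rw [shift, h, Finset.sum_singleton]

theorem shift_tail_succ (f : ℕ → ℂ) (k : ℕ) : shift tail f (k + 1) = f k + f (k + 2) := by
  have h : tail.neighborFinset (k + 1) = {k, k + 2} := by
    ext j
    rw [SimpleGraph.mem_neighborFinset, Finset.mem_insert, Finset.mem_singleton]
    change k + 1 + 1 = j ∨ j + 1 = k + 1 ↔ _
    omega
  rw [shift, h, Finset.sum_pair (by omega)]

theorem tailShift_eq_leftShift_add_rightShift : tailShift p = leftShift p + rightShift p := by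
  ext f (_ | k)
  · change shift tail f 0 = leftShift p f 0 + rightShift p f 0
    simp [shift_tail_zero]
  · change shift tail f (k + 1) = leftShift p f (k + 1) + rightShift p f (k + 1)
    rw [shift_tail_succ, leftShift_apply, rightShift_apply_succ, add_comm]

theorem tailShift_sub_add_inv_eq_mul {b : ℂ} (hb : b ≠ 0) :
    tailShift p - (b + b⁻¹) • ContinuousLinearMap.id ℂ _ =
      (-b⁻¹) • ((1 - b • leftShift p) * (1 - b • rightShift p)) := by
  change _ - (b + b⁻¹) • 1 = _
  rw [tailShift_eq_leftShift_add_rightShift, mul_sub, mul_one, sub_mul, one_mul,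
    smul_mul_smul_comm, leftShift_mul_rightShift]
  simp only [smul_sub, smul_smul, neg_mul, inv_mul_cancel₀ hb, inv_mul_cancel_left₀ hb]
  module

theorem injective_one_sub_smul_rightShift (b : ℂ) :
    Function.Injective (1 - b • rightShift p : lp (fun _ : ℕ => ℂ) p →L[ℂ] _) := by
  refine (injective_iff_map_eq_zero _).2 fun f hf => ?_
  have hf' : f = b • rightShift p f := sub_eq_zero.1 hf
  ext k
  induction k with
  | zero => rw [hf']; simp
  | succ k ih => rw [hf']; simpa using Or.inr ih

theorem smul_rightShift_pow_single_apply (b : ℂ) (i k : ℕ) :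
    ((b • rightShift p) ^ i) (lp.single p 0 1) k = if k = i then b ^ i else 0 := by
  induction i generalizing k with
  | zero => simp [Pi.single_apply]
  | succ i ih =>
    rw [pow_succ', mul_apply_eq_comp]
    change b * rightShift p _ k = _
    rcases k with _ | k
    · simp
    · rw [rightShift_apply_succ, ih, mul_ite, mul_zero, ← pow_succ']
      simp

theorem le_norm_geom_sum_smul_rightShift_sq {b : ℂ} (hb : ‖b‖ = 1) (q : ℕ) :
    q ≤ ‖((∑ i ∈ Finset.range q, (b • rightShift p) ^ i) ^ 2) (lp.single p 0 1)‖ := by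
  rcases q with _ | m
  · simp
  have hval : ((∑ i ∈ Finset.range (m + 1), (b • rightShift p) ^ i) ^ 2) (lp.single p 0 1) m =
      (m + 1) * b ^ m := by
    rw [sq, Finset.sum_mul_sum]
    simp only [← pow_add, sum_apply, lp.coeFn_sum, Finset.sum_apply,
      smul_rightShift_pow_single_apply]
    have hrow : ∀ i ∈ Finset.range (m + 1),
        ∑ j ∈ Finset.range (m + 1), (if m = i + j then b ^ (i + j) else 0) = b ^ m := by
      intro i hi
      have him := Finset.mem_range_succ_iff.1 hi
      rw [Finset.sum_eq_single (m - i)] <;> grind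
    rw [Finset.sum_congr rfl hrow]
    simp
  calc ((m + 1 : ℕ) : ℝ) = ‖((m : ℂ) + 1) * b ^ m‖ := by
        rw [norm_mul, norm_pow, hb, one_pow, mul_one]
        exact_mod_cast (Complex.norm_natCast (m + 1)).symm
    _ ≤ _ := hval ▸ lp.norm_apply_le_norm (one_pos.trans_le Fact.out).ne' _ m

theorem norm_one_sub_sq_mul_geom_sum_sq_apply_le {𝕜 E : Type*} [NontriviallyNormedField 𝕜]
    [NormedAddCommGroup E] [NormedSpace 𝕜 E] {X : E →L[𝕜] E} (hX : ‖X‖ ≤ 1) (q : ℕ) (x : E) :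
    ‖(1 - X) ((1 - X) (((∑ i ∈ Finset.range q, X ^ i) ^ 2) x))‖ ≤ 4 * ‖x‖ := by
  set G := ∑ i ∈ Finset.range q, X ^ i with hG
  have hgeom : (1 - X) * ((1 - X) * G ^ 2) = (1 - X ^ q) ^ 2 := by
    have hcomm : Commute (1 - X) G :=
      (Commute.one_left G).sub_left (Commute.sum_right _ _ _ fun i _ => Commute.self_pow X i)
    rw [← mul_assoc, ← sq, ← hcomm.mul_pow, hG, mul_neg_geom_sum]
  have hXpow : ‖X ^ q‖ ≤ 1 := by
    rcases q.eq_zero_or_pos with rfl | hq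
    · exact ContinuousLinearMap.norm_id_le
    · exact (norm_pow_le' X hq).trans (pow_le_one₀ (norm_nonneg X) hX)
  have hXq : ‖1 - X ^ q‖ ≤ 1 + 1 :=
    (norm_sub_le _ _).trans (add_le_add ContinuousLinearMap.norm_id_le hXpow)
  calc ‖(1 - X) ((1 - X) ((G ^ 2) x))‖ = ‖((1 - X ^ q) ^ 2 : E →L[𝕜] E) x‖ := by
        rw [← hgeom]
        rfl
    _ ≤ (1 + 1) ^ 2 * ‖x‖ :=
        ((1 - X ^ q) ^ 2).le_of_opNorm_le ((norm_pow_le' _ two_pos).trans (by gcongr)) x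
    _ = 4 * ‖x‖ := by norm_num

-- If `1 - bR` were bounded below by `C⁻¹`, its square would be bounded below by `C⁻²`; but with
-- `G = ∑_{i < q} (bR)ⁱ` the norm of `G² e₀` is at least `q`, while `(1 - bR)² G² e₀ =
-- (1 - (bR)^q)² e₀` stays bounded.
theorem not_isFredholm_tailShift_sub_add_inv {b : ℂ} (hb : ‖b‖ = 1) :
    ¬ (tailShift p - (b + b⁻¹) • ContinuousLinearMap.id ℂ _).IsFredholm := by
  intro hF
  have hb0 : b ≠ 0 := norm_pos_iff.1 (by rw [hb]; exact one_pos)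
  rw [tailShift_sub_add_inv_eq_mul hb0, ← smul_mul_assoc] at hF
  obtain ⟨C, hC0, hC⟩ :=
    exists_norm_le_mul_of_isFredholm_comp hF (injective_one_sub_smul_rightShift b)
  have hnorm : ‖b • rightShift p‖ ≤ 1 := by
    rw [norm_smul, hb, one_mul]
    exact norm_extendLp_le _
  set e₀ : lp (fun _ : ℕ => ℂ) p := lp.single p 0 1
  obtain ⟨q, hq⟩ := exists_nat_gt (C * (C * (4 * ‖e₀‖)))
  set f := ((∑ i ∈ Finset.range q, (b • rightShift p) ^ i) ^ 2) e₀
  have hbound : (q : ℝ) ≤ C * (C * (4 * ‖e₀‖)) := by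
    calc (q : ℝ) ≤ ‖f‖ := le_norm_geom_sum_smul_rightShift_sq hb q
      _ ≤ C * ‖(1 - b • rightShift p) f‖ := hC _
      _ ≤ C * (C * ‖(1 - b • rightShift p) ((1 - b • rightShift p) f)‖) := by
        gcongr
        exact hC _
      _ ≤ C * (C * (4 * ‖e₀‖)) := by
        gcongr
        exact norm_one_sub_sq_mul_geom_sum_sq_apply_le hnorm q e₀
  exact hbound.not_gt hq

theorem isUnit_tailShift_sub_add_inv {b : ℂ} (hb0 : b ≠ 0) (hb : ‖b‖ < 1) :
    IsUnit (tailShift p - (b + b⁻¹) • ContinuousLinearMap.id ℂ _) := by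
  have hunit : ∀ A : lp (fun _ : ℕ => ℂ) p →L[ℂ] lp (fun _ : ℕ => ℂ) p, ‖A‖ ≤ 1 →
      IsUnit (1 - b • A) := by
    intro A hA
    refine isUnit_one_sub_of_norm_lt_one ?_
    rw [norm_smul]
    exact mul_lt_one_of_nonneg_of_lt_one_left (norm_nonneg b) hb hA
  rw [tailShift_sub_add_inv_eq_mul hb0, Algebra.smul_def]
  exact ((isUnit_iff_ne_zero.2 (neg_ne_zero.2 (inv_ne_zero hb0))).map _).mul
    ((hunit _ (norm_restrictLp_le _)).mul (hunit _ (norm_extendLp_le _)))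

end Tail

section Band

theorem exists_eq_add_inv (z : ℂ) : ∃ b : ℂ, b ≠ 0 ∧ ‖b‖ ≤ 1 ∧ z = b + b⁻¹ := by
  obtain ⟨s, hs⟩ := IsAlgClosed.exists_pow_nat_eq (z ^ 2 - 4) (n := 2) two_pos
  have key : ((z + s) / 2) * ((z - s) / 2) = 1 := by linear_combination (-1 / 4 : ℂ) * hs
  have h1 : (z + s) / 2 ≠ 0 := left_ne_zero_of_mul_eq_one key
  have h2 : (z - s) / 2 ≠ 0 := right_ne_zero_of_mul_eq_one key
  rcases le_total ‖(z + s) / 2‖ 1 with h | h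
  · refine ⟨(z + s) / 2, h1, h, ?_⟩
    rw [← eq_inv_of_mul_eq_one_right key]
    ring
  · refine ⟨(z - s) / 2, h2, ?_, ?_⟩
    · rw [eq_inv_of_mul_eq_one_right key, norm_inv]
      exact inv_le_one_of_one_le₀ h
    · rw [← eq_inv_of_mul_eq_one_left key]
      ring

theorem add_inv_mem_band {b : ℂ} (hb : ‖b‖ = 1) : b + b⁻¹ ∈ band := by
  have h1 : b⁻¹ = (starRingEnd ℂ) b := Complex.inv_eq_conj hb
  refine ⟨2 * b.re, ?_, ?_⟩
  · have := Complex.abs_re_le_norm b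
    rw [hb, abs_le] at this
    constructor <;> linarith
  · rw [h1, Complex.add_conj]

theorem exists_norm_eq_one_of_mem_band {z : ℂ} (hz : z ∈ band) :
    ∃ b : ℂ, ‖b‖ = 1 ∧ z = b + b⁻¹ := by
  obtain ⟨x, ⟨hx1, hx2⟩, rfl⟩ := hz
  have hn : Real.cos (Real.arccos (x / 2)) = x / 2 :=
    Real.cos_arccos (by linarith) (by linarith)
  refine ⟨Complex.exp (Real.arccos (x / 2) * Complex.I), Complex.norm_exp_ofReal_mul_I _, ?_⟩
  rw [← Complex.exp_neg, ← neg_mul, ← Complex.two_cos, ← Complex.ofReal_cos, hn]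
  push_cast
  ring

theorem exists_norm_lt_one_of_notMem_band {z : ℂ} (hz : z ∉ band) :
    ∃ b : ℂ, b ≠ 0 ∧ ‖b‖ < 1 ∧ z = b + b⁻¹ := by
  obtain ⟨b, hb0, hb1, rfl⟩ := exists_eq_add_inv z
  exact ⟨b, hb0, lt_of_le_of_ne hb1 fun h => hz (add_inv_mem_band h), rfl⟩

end Band

section TailSpectrum

variable {p : ℝ≥0∞} [Fact (1 ≤ p)]

theorem band_subset_essentialSpectrum_tailShift : band ⊆ essentialSpectrum (tailShift p) := by
  intro z hz
  obtain ⟨b, hb, rfl⟩ := exists_norm_eq_one_of_mem_band hz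
  exact not_isFredholm_tailShift_sub_add_inv hb

theorem isUnit_tailShift_sub_of_notMem_band {z : ℂ} (hz : z ∉ band) :
    IsUnit (tailShift p - z • ContinuousLinearMap.id ℂ _) := by
  obtain ⟨b, hb0, hb, rfl⟩ := exists_norm_lt_one_of_notMem_band hz
  exact isUnit_tailShift_sub_add_inv hb0 hb

theorem spectrum_tailShift_subset_band : spectrum ℂ (tailShift p) ⊆ band := fun _ hz =>
  by_contra fun h => notMem_spectrum_iff.2 (isUnit_tailShift_sub_of_notMem_band h) hz

variable (p)

theorem essentialSpectrum_tailShift : essentialSpectrum (tailShift p) = band :=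
  ((essentialSpectrum_subset_spectrum _).trans spectrum_tailShift_subset_band).antisymm
    band_subset_essentialSpectrum_tailShift

theorem spectrum_tailShift : spectrum ℂ (tailShift p) = band :=
  spectrum_tailShift_subset_band.antisymm
    (band_subset_essentialSpectrum_tailShift.trans (essentialSpectrum_subset_spectrum _))

end TailSpectrum

/-! ### Comparing a graph with a tail to the tail -/

section HasFiniteRange

variable {𝕜 E F X : Type*} [NormedField 𝕜] [AddCommGroup E] [Module 𝕜 E]
  [NormedAddCommGroup F] [NormedSpace 𝕜 F] [FiniteDimensional 𝕜 F] {p : ℝ≥0∞}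

theorem hasFiniteRange_of_forall_notMem_eq_zero (D : E →ₗ[𝕜] lp (fun _ : X => F) p) {s : Set X}
    (hs : s.Finite) (hD : ∀ f, ∀ x ∉ s, D f x = 0) : D.HasFiniteRange := by
  have := hs.to_subtype
  let ρ : D.range →ₗ[𝕜] (s → F) :=
    { toFun g x := (g : lp (fun _ : X => F) p) x
      map_add' _ _ := rfl
      map_smul' _ _ := rfl }
  have hρ : Function.Injective ρ := by
    rw [injective_iff_map_eq_zero]
    rintro ⟨_, f, rfl⟩ hf
    refine Subtype.ext (lp.ext (funext fun x => ?_))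
    by_cases hx : x ∈ s
    · exact congrFun hf ⟨x, hx⟩
    · exact hD f x hx
  exact Module.Finite.iff_fg.1 (Module.Finite.of_injective ρ hρ)

end HasFiniteRange

section AttachTail

variable {V : Type*}

variable (V) in
/-- The restriction of a function on `V ⊕ ℕ` to the tail. -/
def restrictTail (p : ℝ≥0∞) [Fact (1 ≤ p)] :
    lp (fun _ : V ⊕ ℕ => ℂ) p →L[ℂ] lp (fun _ : ℕ => ℂ) p :=
  restrictLp ℂ ℂ p Sum.inr_injective

variable (V) in
/-- The extension by zero of a function on the tail to `V ⊕ ℕ`. -/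
def extendTail (p : ℝ≥0∞) [Fact (1 ≤ p)] :
    lp (fun _ : ℕ => ℂ) p →L[ℂ] lp (fun _ : V ⊕ ℕ => ℂ) p :=
  extendLp ℂ ℂ p Sum.inr_injective

theorem extendTail_apply_inr {p : ℝ≥0∞} [Fact (1 ≤ p)] (f : lp (fun _ : ℕ => ℂ) p) (k : ℕ) :
    extendTail V p f (Sum.inr k) = f k :=
  extendLp_apply_self Sum.inr_injective f k

theorem restrictTail_comp_extendTail (p : ℝ≥0∞) [Fact (1 ≤ p)] :
    restrictTail V p ∘L extendTail V p = .id ℂ _ :=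
  restrictLp_comp_extendLp Sum.inr_injective

theorem hasFiniteRange_id_sub_extendTail_comp_restrictTail [Finite V] (p : ℝ≥0∞) [Fact (1 ≤ p)] :
    (ContinuousLinearMap.id ℂ _ - extendTail V p ∘L restrictTail V p).HasFiniteRange := by
  refine hasFiniteRange_of_forall_notMem_eq_zero _ (Set.finite_range Sum.inl) fun f x hx => ?_
  rcases x with v | k
  · exact absurd ⟨v, rfl⟩ hx
  · exact sub_eq_zero.2 (extendTail_apply_inr (restrictTail V p f) k).symm

variable [Fintype V] (H : SimpleGraph V) (v₀ : V)

theorem shift_attachTail_inr_zero (f : V ⊕ ℕ → ℂ) :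
    shift (attachTail H v₀) f (Sum.inr 0) = f (Sum.inl v₀) + f (Sum.inr 1) := by
  classical
  have h : (attachTail H v₀).neighborFinset (Sum.inr 0) = {Sum.inl v₀, Sum.inr 1} := by
    ext y
    rw [SimpleGraph.mem_neighborFinset, Finset.mem_insert, Finset.mem_singleton]
    rcases y with a | k
    · change a = v₀ ∧ (0 : ℕ) = 0 ↔ _
      simp
    · change 0 + 1 = k ∨ k + 1 = 0 ↔ _
      simp [eq_comm]
  rw [shift, h, Finset.sum_pair (by simp)]

theorem shift_attachTail_inr_succ (f : V ⊕ ℕ → ℂ) (k : ℕ) :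
    shift (attachTail H v₀) f (Sum.inr (k + 1)) = f (Sum.inr k) + f (Sum.inr (k + 2)) := by
  classical
  have h : (attachTail H v₀).neighborFinset (Sum.inr (k + 1)) =
      {Sum.inr k, Sum.inr (k + 2)} := by
    ext y
    rw [SimpleGraph.mem_neighborFinset, Finset.mem_insert, Finset.mem_singleton]
    rcases y with a | j
    · change a = v₀ ∧ k + 1 = 0 ↔ _
      simp
    · change k + 1 + 1 = j ∨ j + 1 = k + 1 ↔ _
      rw [Sum.inr.injEq, Sum.inr.injEq]
      omega
  rw [shift, h, Finset.sum_pair (by simp)]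

theorem shift_attachTail_inl_of_ne [H.LocallyFinite] (f : V ⊕ ℕ → ℂ) {a : V} (ha : a ≠ v₀) :
    shift (attachTail H v₀) f (Sum.inl a) = shift H (f ∘ Sum.inl) a := by
  classical
  have h : (attachTail H v₀).neighborFinset (Sum.inl a) =
      (H.neighborFinset a).map Function.Embedding.inl := by
    ext y
    rw [SimpleGraph.mem_neighborFinset]
    rcases y with b | k
    · change H.Adj a b ↔ _
      simp
    · change a = v₀ ∧ k = 0 ↔ _
      simp [ha]
  rw [shift, h, Finset.sum_map]
  rfl

theorem shift_attachTail_inl_self [H.LocallyFinite] (f : V ⊕ ℕ → ℂ) :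
    shift (attachTail H v₀) f (Sum.inl v₀) = shift H (f ∘ Sum.inl) v₀ + f (Sum.inr 0) := by
  classical
  have h : (attachTail H v₀).neighborFinset (Sum.inl v₀) =
      insert (Sum.inr 0) ((H.neighborFinset v₀).map Function.Embedding.inl) := by
    ext y
    rw [SimpleGraph.mem_neighborFinset]
    rcases y with b | k
    · change H.Adj v₀ b ↔ _
      simp
    · change v₀ = v₀ ∧ k = 0 ↔ _
      simp
  rw [shift, h, Finset.sum_insert (by simp), Finset.sum_map, add_comm]
  rfl

variable (p : ℝ≥0∞) [Fact (1 ≤ p)]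

theorem hasFiniteRange_attachTailShift_sub (z : ℂ) :
    (attachTailShift H v₀ p - z • ContinuousLinearMap.id ℂ _ - extendTail V p ∘L
      (tailShift p - z • ContinuousLinearMap.id ℂ _) ∘L restrictTail V p).HasFiniteRange := by
  refine hasFiniteRange_of_forall_notMem_eq_zero _
    ((Set.finite_range Sum.inl).union (Set.finite_singleton (Sum.inr 0))) fun f x hx => ?_
  rcases x with v | _ | k
  · exact absurd (Or.inl ⟨v, rfl⟩) hx
  · exact absurd (Or.inr rfl) hx
  · change (shift (attachTail H v₀) f (Sum.inr (k + 1)) - z * f (Sum.inr (k + 1))) -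
      extendTail V p _ (Sum.inr (k + 1)) = 0
    rw [extendTail_apply_inr, sub_eq_zero, shift_attachTail_inr_succ]
    exact congrArg (· - _) (shift_tail_succ (restrictTail V p f) k).symm

theorem essentialSpectrum_attachTailShift : essentialSpectrum (attachTailShift H v₀ p) = band := by
  rw [← essentialSpectrum_tailShift p]
  ext z
  exact not_congr (isFredholm_iff_of_hasFiniteRange_sub_comp (restrictTail_comp_extendTail p)
    (hasFiniteRange_id_sub_extendTail_comp_restrictTail p)
    (hasFiniteRange_attachTailShift_sub H v₀ p z))

theorem spectrum_attachTailShift_eq_union_pointSpectrum :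
    spectrum ℂ (attachTailShift H v₀ p) = band ∪ pointSpectrum (attachTailShift H v₀ p) := by
  refine Set.Subset.antisymm (fun z hz => ?_)
    (Set.union_subset ?_ (pointSpectrum_subset_spectrum _))
  · by_contra h
    rw [Set.mem_union, not_or] at h
    refine notMem_spectrum_iff.2 ?_ hz
    exact isUnit_of_injective_of_hasFiniteRange_sub_comp (restrictTail_comp_extendTail p)
      (hasFiniteRange_id_sub_extendTail_comp_restrictTail p)
      (hasFiniteRange_attachTailShift_sub H v₀ p z)
      (isUnit_tailShift_sub_of_notMem_band h.1) (injective_sub_of_notMem_pointSpectrum h.2)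
  · rw [← essentialSpectrum_attachTailShift H v₀ p]
    exact essentialSpectrum_subset_spectrum _

end AttachTail

/-! ### The eigenvalue recursion on the tail -/

section Recursion

theorem pow_mul_sub_eq_of_recursion {K : Type*} [Field K] {a : ℕ → K} {b : K} (hb : b ≠ 0) {n : ℕ}
    (ha : ∀ k < n, a k + a (k + 2) = (b + b⁻¹) * a (k + 1)) {k : ℕ} (hk : k ≤ n) :
    b ^ k * (a (k + 1) - b * a k) = a 1 - b * a 0 := by
  induction k with
  | zero => ring
  | succ k ih =>
    rw [← ih (Nat.le_of_succ_le hk), eq_sub_of_add_eq' (ha k hk)]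
    field_simp
    ring

variable {𝕜 : Type*} [NormedField 𝕜] {a : ℕ → 𝕜} {b : 𝕜}

theorem eq_pow_mul_of_recursion_of_tendsto (hb : b ≠ 0)
    (ha : ∀ k, a k + a (k + 2) = (b + b⁻¹) * a (k + 1))
    (hlim : Tendsto (fun k => b ^ k * (a (k + 1) - b * a k)) atTop (𝓝 0)) (k : ℕ) :
    a k = b ^ k * a 0 := by
  have hconst : ∀ k, b ^ k * (a (k + 1) - b * a k) = a 1 - b * a 0 := fun k =>
    pow_mul_sub_eq_of_recursion hb (fun j _ => ha j) le_rfl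
  have hzero : a 1 - b * a 0 = 0 :=
    tendsto_nhds_unique tendsto_const_nhds (hlim.congr hconst)
  induction k with
  | zero => simp
  | succ k ih =>
    have hk := (mul_eq_zero_iff_left (pow_ne_zero k hb)).1 ((hconst k).trans hzero)
    rw [sub_eq_zero.1 hk, ih, pow_succ', mul_assoc]

theorem eq_pow_mul_of_recursion_of_bounded (hb : b ≠ 0) (hb1 : ‖b‖ < 1)
    (ha : ∀ k, a k + a (k + 2) = (b + b⁻¹) * a (k + 1)) {C : ℝ} (hC : ∀ k, ‖a k‖ ≤ C) (k : ℕ) :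
    a k = b ^ k * a 0 := by
  refine eq_pow_mul_of_recursion_of_tendsto hb ha ?_ k
  refine (tendsto_pow_atTop_nhds_zero_of_norm_lt_one hb1).zero_mul_isBoundedUnder_le
    (isBoundedUnder_of ⟨C + ‖b‖ * C, fun k => ?_⟩)
  calc ‖a (k + 1) - b * a k‖ ≤ ‖a (k + 1)‖ + ‖b‖ * ‖a k‖ :=
        (norm_sub_le _ _).trans_eq (congrArg _ (norm_mul _ _))
    _ ≤ C + ‖b‖ * C := by
        gcongr
        exacts [hC _, hC k]

theorem eq_zero_of_recursion_of_tendsto (hb1 : ‖b‖ = 1)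
    (ha : ∀ k, a k + a (k + 2) = (b + b⁻¹) * a (k + 1)) (hlim : Tendsto a atTop (𝓝 0)) (k : ℕ) :
    a k = 0 := by
  have hb : b ≠ 0 := norm_pos_iff.1 (hb1 ▸ one_pos)
  have hdiff : Tendsto (fun k => a (k + 1) - b * a k) atTop (𝓝 0) := by
    simpa using (hlim.comp (tendsto_add_atTop_nat 1)).sub (hlim.const_mul b)
  have hpow : ∀ k, a k = b ^ k * a 0 := by
    refine eq_pow_mul_of_recursion_of_tendsto hb ha ?_
    refine isBoundedUnder_le_mul_tendsto_zero (isBoundedUnder_of ⟨1, fun k => ?_⟩) hdiff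
    simp [hb1]
  have hnorm : ∀ k, ‖a k‖ = ‖a 0‖ := fun k => by rw [hpow k, norm_mul, norm_pow, hb1]; simp
  have h0 : ‖a 0‖ = 0 :=
    tendsto_nhds_unique (tendsto_const_nhds.congr fun k => (hnorm k).symm)
      (by simpa using hlim.norm)
  exact norm_eq_zero.1 ((hnorm k).trans h0)

end Recursion

/-! ### Eigenvalues of a finite graph with a tail -/

section Memℓp

variable {α β E : Type*} [NormedAddCommGroup E] {p : ℝ≥0∞}

theorem tendsto_cofinite_zero_of_memℓp {f : α → E} (hp : 0 < p.toReal) (hf : Memℓp f p) :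
    Tendsto f cofinite (𝓝 0) := by
  have h := (hf.summable hp).tendsto_cofinite_zero.rpow_const (p := p.toReal⁻¹)
    (Or.inr (inv_nonneg.2 hp.le))
  rw [Real.zero_rpow (inv_ne_zero hp.ne')] at h
  exact tendsto_zero_iff_norm_tendsto_zero.2
    (h.congr fun a => Real.rpow_rpow_inv (norm_nonneg _) hp.ne')

theorem memℓp_sumElim {f : α → E} {g : β → E} (hf : Memℓp f p) (hg : Memℓp g p) :
    Memℓp (Sum.elim f g) p := by
  convert (memℓp_extend_zero Sum.inl_injective hf).add (memℓp_extend_zero Sum.inr_injective hg)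
  ext (a | b) <;> simp [Sum.inl_injective.extend_apply, Sum.inr_injective.extend_apply]

theorem memℓp_pow_of_norm_lt_one {𝕜 : Type*} [NormedField 𝕜] {b : 𝕜} (hb : ‖b‖ < 1)
    (hp : 1 ≤ p) : Memℓp (fun k : ℕ => b ^ k) p := by
  have h : Memℓp (fun k : ℕ => b ^ k) 1 := by
    refine memℓp_gen ?_
    simpa only [ENNReal.toReal_one, Real.rpow_one, norm_pow] using
      summable_geometric_of_lt_one (norm_nonneg b) hb
  exact h.of_exponent_ge hp

end Memℓp

section TruncatedEigenfunction

open scoped Matrix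

variable {V : Type*} (H : SimpleGraph V) [H.LocallyFinite] (v₀ : V)

/-- The eigenvalue equations at the vertices of `H` for a function that is equal to `f` on `H` and
to `c` at the first vertex of the tail. -/
def IsTruncatedEigenfunction (z c : ℂ) (f : V → ℂ) : Prop :=
  shift H f v₀ + c = z * f v₀ ∧ ∀ v, v ≠ v₀ → shift H f v = z * f v

variable {H v₀}

theorem isTruncatedEigenfunction_zero_iff {z : ℂ} {f : V → ℂ} :
    IsTruncatedEigenfunction H v₀ z 0 f ↔ ∀ v, shift H f v = z * f v := by
  rw [IsTruncatedEigenfunction, add_zero]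
  refine ⟨fun h v => ?_, fun h => ⟨h v₀, fun v _ => h v⟩⟩
  by_cases hv : v = v₀
  · exact hv ▸ h.1
  · exact h.2 v hv

theorem shift_const_mul (c : ℂ) (f : V → ℂ) (v : V) :
    shift H (fun w => c * f w) v = c * shift H f v :=
  (Finset.mul_sum _ _ _).symm

theorem isTruncatedEigenfunction_const_mul {z c : ℂ} {f : V → ℂ} (a : ℂ)
    (hf : IsTruncatedEigenfunction H v₀ z c f) :
    IsTruncatedEigenfunction H v₀ z (a * c) fun v => a * f v := by
  refine ⟨?_, fun v hv => ?_⟩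
  · rw [shift_const_mul, ← mul_add, hf.1, mul_left_comm]
  · rw [shift_const_mul, hf.2 v hv, mul_left_comm]

theorem mem_finiteSystemEigenvalues_iff {z : ℂ} :
    z ∈ finiteSystemEigenvalues H v₀ ↔ ∃ b f, b ≠ 0 ∧ z = b + b⁻¹ ∧ (‖b‖ < 1 ∨ f v₀ = 0) ∧
      f ≠ 0 ∧ IsTruncatedEigenfunction H v₀ z (b * f v₀) f := by
  constructor
  · rintro (⟨f, hf, hf0, hfz⟩ | ⟨b, hb0, hb, hz, f, hf0, hfz⟩)
    · obtain ⟨b, hb0, -, hz⟩ := exists_eq_add_inv z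
      refine ⟨b, f, hb0, hz, Or.inr hf0, hf, ?_⟩
      rw [hf0, mul_zero]
      exact isTruncatedEigenfunction_zero_iff.2 hfz
    · have hf : f ≠ 0 := fun h => one_ne_zero (hf0.symm.trans (congrFun h v₀))
      refine ⟨b, f, hb0, one_div b ▸ hz, Or.inl hb, hf, ?_⟩
      rwa [hf0, mul_one]
  · rintro ⟨b, f, hb0, hz, hb, hf, hfz⟩
    by_cases hf0 : f v₀ = 0
    · rw [hf0, mul_zero] at hfz
      exact Or.inl ⟨f, hf, hf0, isTruncatedEigenfunction_zero_iff.1 hfz⟩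
    · have h := isTruncatedEigenfunction_const_mul (f v₀)⁻¹ hfz
      rw [mul_left_comm, inv_mul_cancel₀ hf0, mul_one] at h
      exact Or.inr ⟨b, hb0, hb.resolve_right hf0, (one_div b).symm ▸ hz, _,
        inv_mul_cancel₀ hf0, h⟩

theorem sum_conj_mul_shift_of_isTruncatedEigenfunction [Fintype V] {z c : ℂ} {f : V → ℂ}
    (hf : IsTruncatedEigenfunction H v₀ z c f) :
    ∑ v, star (f v) * shift H f v = z * ((∑ v, ‖f v‖ ^ 2 : ℝ) : ℂ) - star (f v₀) * c := by
  classical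
  have hsum : ∀ v, star (f v) * shift H f v =
      z * (‖f v‖ ^ 2 : ℝ) - if v = v₀ then star (f v₀) * c else 0 := by
    intro v
    have hnorm : ((‖f v‖ ^ 2 : ℝ) : ℂ) = star (f v) * f v := by
      rw [Complex.ofReal_pow]
      exact (Complex.conj_mul' (f v)).symm
    rw [hnorm]
    split_ifs with hv
    · rw [hv]
      linear_combination star (f v₀) * hf.1
    · rw [hf.2 v hv]
      ring
  simp only [hsum, Finset.sum_sub_distrib, Finset.sum_ite_eq', Finset.mem_univ, if_true,
    ← Finset.mul_sum, Complex.ofReal_sum]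

theorem im_sum_conj_mul_shift [Fintype V] (f : V → ℂ) : (∑ v, star (f v) * shift H f v).im = 0 := by
  classical
  have hshift : H.adjMatrix ℂ *ᵥ f = shift H f := by
    ext v
    rw [SimpleGraph.adjMatrix_mulVec_apply, shift]
    congr!
  exact hshift ▸ (H.isHermitian_adjMatrix (R := ℂ)).im_star_dotProduct_mulVec_self f

theorem im_eq_zero_of_isTruncatedEigenfunction [Finite V] {b : ℂ} (hb0 : b ≠ 0) (hb : ‖b‖ < 1)
    {f : V → ℂ} (hf0 : f v₀ = 1) (hf : IsTruncatedEigenfunction H v₀ (b + b⁻¹) b f) :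
    b.im = 0 := by
  cases nonempty_fintype V
  have him := im_sum_conj_mul_shift (H := H) f
  rw [sum_conj_mul_shift_of_isTruncatedEigenfunction hf, hf0, star_one, one_mul, Complex.sub_im,
    Complex.im_mul_ofReal, Complex.add_im, Complex.inv_im] at him
  set s := ∑ v, ‖f v‖ ^ 2
  set n := Complex.normSq b with hn
  have hs : 0 ≤ s := Finset.sum_nonneg fun _ _ => by positivity
  have hn0 : 0 < n := Complex.normSq_pos.2 hb0
  have hn1 : n < 1 := by
    rw [hn, Complex.normSq_eq_norm_sq]
    exact pow_lt_one₀ (norm_nonneg b) hb two_ne_zero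
  have hprod : b.im * (n + (1 - n) * s) = 0 := by
    field_simp at him
    linear_combination -him
  have hpos : 0 < n + (1 - n) * s := add_pos_of_pos_of_nonneg hn0 (mul_nonneg (by linarith) hs)
  exact (mul_eq_zero_iff_right hpos.ne').1 hprod

end TruncatedEigenfunction

section Eigenvalues

variable {V : Type*} {H : SimpleGraph V} {v₀ : V}

variable (v₀) in
/-- The values of a function on `V ⊕ ℕ` along the ray that starts at `v₀` and follows the tail. -/
def tailSequence (x : V ⊕ ℕ → ℂ) : ℕ → ℂ
  | 0 => x (Sum.inl v₀)
  | k + 1 => x (Sum.inr k)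

variable {p : ℝ≥0∞} [Fact (1 ≤ p)] {z : ℂ}

theorem tendsto_tailSequence (hp : p ≠ ∞) (x : lp (fun _ : V ⊕ ℕ => ℂ) p) :
    Tendsto (tailSequence v₀ x) atTop (𝓝 0) := by
  refine (tendsto_add_atTop_iff_nat 1).1 ?_
  have hp0 : 0 < p.toReal := one_pos.trans_le (one_le_toReal Fact.out hp)
  rw [← Nat.cofinite_eq_atTop]
  exact (tendsto_cofinite_zero_of_memℓp hp0 (lp.memℓp x)).comp
    Sum.inr_injective.tendsto_cofinite

theorem exists_tailSequence_eq_pow_mul {x : lp (fun _ : V ⊕ ℕ => ℂ) p} (h : p ≠ ∞ ∨ z ∉ band)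
    (hx : ∀ k, tailSequence v₀ x k + tailSequence v₀ x (k + 2) = z * tailSequence v₀ x (k + 1)) :
    ∃ b : ℂ, b ≠ 0 ∧ z = b + b⁻¹ ∧ (‖b‖ < 1 ∨ tailSequence v₀ x 0 = 0) ∧
      ∀ k, tailSequence v₀ x k = b ^ k * tailSequence v₀ x 0 := by
  obtain ⟨b, hb0, hb1, rfl⟩ := exists_eq_add_inv z
  refine ⟨b, hb0, rfl, ?_⟩
  rcases hb1.lt_or_eq with hb | hb
  · have hbound : ∀ k, ‖tailSequence v₀ x k‖ ≤ ‖x‖ := by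
      rintro (_ | k) <;> exact lp.norm_apply_le_norm (one_pos.trans_le Fact.out).ne' x _
    exact ⟨Or.inl hb, eq_pow_mul_of_recursion_of_bounded hb0 hb hx hbound⟩
  · have hp : p ≠ ∞ := h.resolve_right fun hband => hband (add_inv_mem_band hb)
    have hzero := eq_zero_of_recursion_of_tendsto hb hx (tendsto_tailSequence hp x)
    exact ⟨Or.inr (hzero 0), fun k => by rw [hzero k, hzero 0, mul_zero]⟩

variable [Fintype V] [H.LocallyFinite]

theorem attachTailShift_apply_eq_smul_iff {x : lp (fun _ : V ⊕ ℕ => ℂ) p} :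
    attachTailShift H v₀ p x = z • x ↔
      IsTruncatedEigenfunction H v₀ z (x (Sum.inr 0)) (x ∘ Sum.inl) ∧
      ∀ k, tailSequence v₀ x k + tailSequence v₀ x (k + 2) = z * tailSequence v₀ x (k + 1) := by
  have hpointwise : attachTailShift H v₀ p x = z • x ↔
      ∀ y, shift (attachTail H v₀) x y = z * x y := lp.ext_iff.trans funext_iff
  rw [hpointwise]
  constructor
  · refine fun h => ⟨⟨?_, fun v hv => ?_⟩, fun k => ?_⟩
    · exact (shift_attachTail_inl_self H v₀ x).symm.trans (h _)
    · exact (shift_attachTail_inl_of_ne H v₀ x hv).symm.trans (h _)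
    · rcases k with _ | k
      · exact (shift_attachTail_inr_zero H v₀ x).symm.trans (h _)
      · exact (shift_attachTail_inr_succ H v₀ x k).symm.trans (h _)
  · rintro ⟨⟨hself, hne⟩, htail⟩ (v | _ | k)
    · by_cases hv : v = v₀
      · exact hv ▸ (shift_attachTail_inl_self H v₀ x).trans hself
      · exact (shift_attachTail_inl_of_ne H v₀ x hv).trans (hne v hv)
    · exact (shift_attachTail_inr_zero H v₀ x).trans (htail 0)
    · exact (shift_attachTail_inr_succ H v₀ x k).trans (htail (k + 1))

theorem mem_finiteSystemEigenvalues_of_mem_pointSpectrum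
    (hz : z ∈ pointSpectrum (attachTailShift H v₀ p)) (h : p ≠ ∞ ∨ z ∉ band) :
    z ∈ finiteSystemEigenvalues H v₀ := by
  obtain ⟨x, hx0, hx⟩ := mem_pointSpectrum_iff.1 hz
  obtain ⟨hH, htail⟩ := attachTailShift_apply_eq_smul_iff.1 hx
  obtain ⟨b, hb0, rfl, hb, hpow⟩ := exists_tailSequence_eq_pow_mul h htail
  have hfirst : x (Sum.inr 0) = b * x (Sum.inl v₀) :=
    (hpow 1).trans (by rw [pow_one]; rfl)
  refine mem_finiteSystemEigenvalues_iff.2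
    ⟨b, x ∘ Sum.inl, hb0, rfl, hb, fun hzero => hx0 ?_, hfirst ▸ hH⟩
  ext (v | k)
  · exact congrFun hzero v
  · exact (hpow (k + 1)).trans (mul_eq_zero_of_right _ (congrFun hzero v₀))

theorem finiteSystemEigenvalues_subset_pointSpectrum :
    finiteSystemEigenvalues H v₀ ⊆ pointSpectrum (attachTailShift H v₀ p) := by
  intro z hz
  obtain ⟨b, f, hb0, rfl, hb, hf, hfz⟩ := mem_finiteSystemEigenvalues_iff.1 hz
  have htail : Memℓp (fun k : ℕ => b ^ (k + 1) * f v₀) p := by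
    rcases hb with hb | hf0
    · have h := (memℓp_pow_of_norm_lt_one hb (Fact.out : 1 ≤ p)).const_mul (b * f v₀)
      simpa only [pow_succ', mul_right_comm] using! h
    · simpa only [hf0, mul_zero] using! zero_memℓp
  let x : lp (fun _ : V ⊕ ℕ => ℂ) p :=
    ⟨Sum.elim f fun k => b ^ (k + 1) * f v₀, memℓp_sumElim (Memℓp.all f) htail⟩
  have hseq : ∀ k, tailSequence v₀ x k = b ^ k * f v₀ := by
    rintro (_ | k)
    · exact (one_mul (f v₀)).symm.trans (by rw [pow_zero])
    · rfl
  refine mem_pointSpectrum_iff.2 ⟨x, fun hx => hf (funext fun v => ?_), ?_⟩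
  · exact congrFun (lp.ext_iff.1 hx) (Sum.inl v)
  · refine attachTailShift_apply_eq_smul_iff.2 ⟨?_, fun k => ?_⟩
    · rw [show x (Sum.inr 0) = b * f v₀ from hseq 1 |>.trans (by rw [pow_one])]
      exact hfz
    · rw [hseq, hseq, hseq]
      field_simp
      ring

variable (H v₀ p)

theorem pointSpectrum_attachTailShift (hp : p ≠ ∞) :
    pointSpectrum (attachTailShift H v₀ p) = finiteSystemEigenvalues H v₀ :=
  Set.Subset.antisymm
    (fun _ hz => mem_finiteSystemEigenvalues_of_mem_pointSpectrum hz (Or.inl hp))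
    finiteSystemEigenvalues_subset_pointSpectrum

theorem spectrum_attachTailShift :
    spectrum ℂ (attachTailShift H v₀ p) = band ∪ finiteSystemEigenvalues H v₀ := by
  rw [spectrum_attachTailShift_eq_union_pointSpectrum]
  refine Set.Subset.antisymm (fun z hz => or_iff_not_imp_left.2 fun hb => ?_)
    (Set.union_subset_union_right _ finiteSystemEigenvalues_subset_pointSpectrum)
  exact mem_finiteSystemEigenvalues_of_mem_pointSpectrum (hz.resolve_left hb) (Or.inr hb)

end Eigenvalues

/-! ### The fly-swatter -/

section FlySwatter

theorem flySwatterRoot_sq_add {n : ℕ} (hn : 2 ≤ n) :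
    ((n : ℝ) - 1) * (flySwatterRoot n ^ 2 + flySwatterRoot n) = 1 := by
  have hn' : (2 : ℝ) ≤ n := Nat.ofNat_le_cast.2 hn
  have hn1 : (0 : ℝ) < n - 1 := by linarith
  have hsqrt := Real.sq_sqrt (div_nonneg (by linarith : (0 : ℝ) ≤ n + 3) hn1.le)
  have hroot : flySwatterRoot n ^ 2 + flySwatterRoot n = (((n : ℝ) + 3) / (n - 1) - 1) / 4 := by
    rw [← hsqrt, flySwatterRoot]
    ring
  rw [hroot]
  field_simp
  ring

theorem flySwatterRoot_pos {n : ℕ} (hn : 2 ≤ n) : 0 < flySwatterRoot n := by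
  have hn' : (2 : ℝ) ≤ n := Nat.ofNat_le_cast.2 hn
  have hsqrt : 1 < Real.sqrt (((n : ℝ) + 3) / (n - 1)) := by
    rw [Real.lt_sqrt zero_le_one, lt_div_iff₀ (by linarith)]
    linarith
  rw [flySwatterRoot]
  linarith

theorem flySwatterRoot_lt_one {n : ℕ} (hn : 2 ≤ n) : flySwatterRoot n < 1 := by
  have hn' : (2 : ℝ) ≤ n := Nat.ofNat_le_cast.2 hn
  have hpos := flySwatterRoot_pos hn
  have hroot := flySwatterRoot_sq_add hn
  nlinarith [mul_nonneg (sub_nonneg.2 hn')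
    (by positivity : 0 ≤ flySwatterRoot n ^ 2 + flySwatterRoot n)]

theorem sub_one_mul_sq_add_eq_one_iff {n : ℕ} (hn : 2 ≤ n) {b : ℂ} (hb : ‖b‖ < 1) :
    ((n : ℂ) - 1) * (b ^ 2 + b) = 1 ↔ b = flySwatterRoot n := by
  set r := flySwatterRoot n
  have hroot : ((n : ℂ) - 1) * ((r : ℂ) ^ 2 + r) = 1 := by
    exact_mod_cast congrArg ((↑) : ℝ → ℂ) (flySwatterRoot_sq_add hn)
  refine ⟨fun h => ?_, fun h => h ▸ hroot⟩
  have hprod : (b - r) * (b + (1 + r)) = 0 := by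
    refine (mul_right_inj' (left_ne_zero_of_mul_eq_one h)).1 ?_
    linear_combination h - hroot
  refine sub_eq_zero.1 (eq_zero_of_ne_zero_of_mul_right_eq_zero (fun hneg => hb.not_ge ?_) hprod)
  have hr0 : 0 < r := flySwatterRoot_pos hn
  rw [eq_neg_of_add_eq_zero_left hneg, norm_neg, ← Complex.ofReal_one, ← Complex.ofReal_add,
    Complex.norm_real]
  exact (le_add_of_nonneg_right hr0.le).trans (le_abs_self _)

variable {V : Type*} [Fintype V] [(⊤ : SimpleGraph V).LocallyFinite] {v₀ : V} {z c : ℂ}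

theorem shift_top (f : V → ℂ) (v : V) : shift (⊤ : SimpleGraph V) f v = ∑ w, f w - f v := by
  classical
  have h : (⊤ : SimpleGraph V).neighborFinset v = Finset.univ.erase v := by
    ext w
    simp [eq_comm]
  rw [shift, h, Finset.sum_erase_eq_sub (Finset.mem_univ v)]

theorem exists_eigenfunction_top_iff (hV : 3 ≤ Fintype.card V) :
    (∃ f : V → ℂ, f ≠ 0 ∧ f v₀ = 0 ∧ ∀ v, shift (⊤ : SimpleGraph V) f v = z * f v) ↔ z = -1 := by
  classical
  simp only [shift_top]
  constructor
  · rintro ⟨f, hf, hf0, hfz⟩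
    have hsum : ∑ w, f w = 0 := by simpa [hf0] using hfz v₀
    obtain ⟨v, hv⟩ := Function.ne_iff.1 hf
    refine mul_right_cancel₀ hv ?_
    rw [← hfz v, hsum, zero_sub, neg_one_mul]
  · rintro rfl
    have hcard : 1 < (Finset.univ.erase v₀).card := by
      rw [Finset.card_erase_of_mem (Finset.mem_univ v₀), Finset.card_univ]
      omega
    obtain ⟨u, hu, w, hw, huw⟩ := Finset.one_lt_card.1 hcard
    refine ⟨Pi.single u 1 - Pi.single w 1, fun h => ?_, ?_, fun v => ?_⟩
    · simpa [huw] using congrFun h u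
    · simp [(Finset.ne_of_mem_erase hu).symm, (Finset.ne_of_mem_erase hw).symm]
    · simp

theorem eq_of_isTruncatedEigenfunction_top {f : V → ℂ} (hf0 : f v₀ = 1)
    (hf : IsTruncatedEigenfunction (⊤ : SimpleGraph V) v₀ z c f) :
    (z + 1 - Fintype.card V) * (z + 1 - c) = c := by
  classical
  simp only [IsTruncatedEigenfunction, shift_top] at hf
  obtain ⟨hself, hne⟩ := hf
  have hsum : ∑ w, f w = z + 1 - c := by
    rw [hf0] at hself
    linear_combination hself
  have hvertex : ∀ v, (z + 1) * f v = (z + 1 - c) + if v = v₀ then c else 0 := by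
    intro v
    split_ifs with hv
    · rw [hv, hf0]
      ring
    · rw [← hsum, add_mul, ← hne v hv]
      ring
  have htotal := Finset.sum_congr (rfl : Finset.univ = Finset.univ) fun v _ => hvertex v
  rw [← Finset.mul_sum, hsum] at htotal
  simp only [Finset.sum_add_distrib, Finset.sum_const, Finset.card_univ, nsmul_eq_mul,
    Finset.sum_ite_eq', Finset.mem_univ, if_true] at htotal
  linear_combination htotal

theorem exists_isTruncatedEigenfunction_top (hz : z + 1 ≠ 0)
    (h : (z + 1 - Fintype.card V) * (z + 1 - c) = c) :
    ∃ f, f v₀ = 1 ∧ IsTruncatedEigenfunction (⊤ : SimpleGraph V) v₀ z c f := by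
  classical
  simp only [IsTruncatedEigenfunction, shift_top]
  set f : V → ℂ := fun v => ((z + 1 - c) + if v = v₀ then c else 0) / (z + 1) with hf
  have hsum : ∑ w, f w = z + 1 - c := by
    rw [← Finset.sum_div, div_eq_iff hz]
    simp only [Finset.sum_add_distrib, Finset.sum_const, Finset.card_univ, nsmul_eq_mul,
      Finset.sum_ite_eq', Finset.mem_univ, if_true]
    linear_combination -h
  have hf0 : f v₀ = 1 := by simp [hf, hz]
  refine ⟨f, hf0, ?_, fun v hv => ?_⟩
  · rw [hsum, hf0]
    ring
  · rw [hsum]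
    simp only [hf, hv, if_false]
    field_simp
    ring

theorem finiteSystemEigenvalues_top {n : ℕ} (hn : 2 ≤ n) (hV : Fintype.card V = n + 1) (v₀ : V) :
    finiteSystemEigenvalues (⊤ : SimpleGraph V) v₀ =
      {-1, ((flySwatterRoot n + 1 / flySwatterRoot n : ℝ) : ℂ)} := by
  have hcubic : ∀ b : ℂ, b ≠ 0 →
      ((b + 1 / b + 1 - Fintype.card V) * (b + 1 / b + 1 - b) = b ↔
        ((n : ℂ) - 1) * (b ^ 2 + b) = 1) := by
    intro b hb0
    rw [hV]
    push_cast
    field_simp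
    constructor <;> intro h <;> linear_combination -h
  ext z
  refine or_congr (exists_eigenfunction_top_iff (by omega)) ⟨?_, fun hz => ?_⟩
  · rintro ⟨b, hb0, hb, rfl, f, hf0, hf⟩
    have hroot := (hcubic b hb0).1 (eq_of_isTruncatedEigenfunction_top hf0 hf)
    rw [(sub_one_mul_sq_add_eq_one_iff hn hb).1 hroot]
    norm_cast
  · have hr0 := flySwatterRoot_pos hn
    have hb0 : (flySwatterRoot n : ℂ) ≠ 0 := Complex.ofReal_ne_zero.2 hr0.ne'
    have hb : ‖(flySwatterRoot n : ℂ)‖ < 1 := by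
      rw [Complex.norm_real, Real.norm_of_nonneg hr0.le]
      exact flySwatterRoot_lt_one hn
    have hz1 : (flySwatterRoot n : ℂ) + 1 / flySwatterRoot n + 1 ≠ 0 := by
      have : flySwatterRoot n + 1 / flySwatterRoot n + 1 ≠ 0 := by positivity
      exact_mod_cast this
    obtain rfl : z = (flySwatterRoot n : ℂ) + 1 / flySwatterRoot n :=
      (Set.mem_singleton_iff.1 hz).trans (by push_cast; rfl)
    exact ⟨flySwatterRoot n, hb0, hb, rfl, exists_isTruncatedEigenfunction_top hz1
      ((hcubic _ hb0).2 ((sub_one_mul_sq_add_eq_one_iff hn hb).2 rfl))⟩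

end FlySwatter

/-! ### The comb -/

section ChebyshevS

open Polynomial.Chebyshev

theorem eval_S_add_two (μ : ℂ) (k : ℤ) :
    (S ℂ (k + 2)).eval μ = μ * (S ℂ (k + 1)).eval μ - (S ℂ k).eval μ := by
  simp only [S_add_two, Polynomial.eval_sub, Polynomial.eval_mul, Polynomial.eval_X]

theorem eval_S_add_one_ne_zero {μ : ℂ} {k : ℤ} (h : (S ℂ k).eval μ = 0) :
    (S ℂ (k + 1)).eval μ ≠ 0 := by
  intro h'
  have hone := congrArg (Polynomial.eval μ) (S_sq_add_S_sq ℂ k)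
  simp [h, h'] at hone

theorem eq_mul_eval_S_of_recursion {μ : ℂ} {a : ℕ → ℂ} {n : ℕ} (ha0 : a 0 = 0)
    (ha : ∀ k < n, a k + a (k + 2) = μ * a (k + 1)) {k : ℕ} (hk : k ≤ n) :
    a k = a 1 * (S ℂ (k - 1)).eval μ ∧ a (k + 1) = a 1 * (S ℂ k).eval μ := by
  induction k with
  | zero => simp [ha0]
  | succ k ih =>
    obtain ⟨ihk, ihk1⟩ := ih (by omega)
    have hS := eval_S_add_two μ (k - 1)
    rw [sub_add_cancel, show (k : ℤ) - 1 + 2 = k + 1 by ring] at hS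
    refine ⟨by simpa using ihk1, ?_⟩
    have hrec := ha k (by omega)
    rw [ihk1, ihk] at hrec
    push_cast
    linear_combination hrec - a 1 * hS

theorem eval_combPoly {b μ : ℂ} (hμ : μ * (b * (b ^ 2 + 1)) = b ^ 4 + b ^ 2 + 1) :
    ∀ n : ℕ, (combPoly (n + 1)).eval b =
      (b * (b ^ 2 + 1)) ^ (n + 1) * ((S ℂ (n + 1)).eval μ - b * (S ℂ n).eval μ)
  | 0 => by
    simp only [combPoly, Polynomial.eval_one, Nat.cast_zero, zero_add, S_zero, S_one,
      Polynomial.eval_X]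
    linear_combination -hμ
  | 1 => by
    simp only [combPoly, Polynomial.eval_add, Polynomial.eval_sub, Polynomial.eval_neg,
      Polynomial.eval_pow, Polynomial.eval_X, Polynomial.eval_one, Nat.cast_one, S_one,
      one_add_one_eq_two, S_two]
    linear_combination (-μ * (b * (b ^ 2 + 1)) - (b ^ 4 + b ^ 2 + 1) + b * (b * (b ^ 2 + 1))) * hμ
  | n + 2 => by
    have ih := eval_combPoly hμ n
    have ih' := eval_combPoly hμ (n + 1)
    have hS := eval_S_add_two μ n
    have hS' := eval_S_add_two μ (n + 1)
    push_cast at ih' ⊢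
    rw [add_right_comm (n : ℤ) 1 2] at hS'
    rw [add_assoc (n : ℤ) 1 1, one_add_one_eq_two] at ih' hS'
    rw [show n + 2 + 1 = n + 3 from rfl, combPoly, hS']
    simp only [Polynomial.eval_add, Polynomial.eval_sub, Polynomial.eval_mul,
      Polynomial.eval_pow, Polynomial.eval_X, Polynomial.eval_one, ih, ih', hS, ← hμ]
    ring

end ChebyshevS

theorem eval_combPoly_zero : ∀ n : ℕ, (combPoly (n + 1)).eval 0 = 1
  | 0 => by simp [combPoly]
  | 1 => by simp [combPoly]
  | n + 2 => by simp [combPoly, eval_combPoly_zero (n + 1)]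

section Comb

theorem shift_eq_sum_ite {V : Type*} [Fintype V] (H : SimpleGraph V) [H.LocallyFinite]
    [DecidableRel H.Adj] (f : V → ℂ) (v : V) :
    shift H f v = ∑ w, if H.Adj v w then f w else 0 := by
  rw [shift, ← Finset.sum_filter]
  refine Finset.sum_congr ?_ fun _ _ => rfl
  ext w
  simp

open Polynomial.Chebyshev

theorem comb_adj_inl_inl {n : ℕ} {i j : Fin n} :
    (comb n).Adj (Sum.inl i) (Sum.inl j) ↔ (j : ℕ) + 1 = i ∨ (i : ℕ) + 1 = j :=
  Or.comm

theorem comb_adj_inl_inr {n : ℕ} {i j : Fin n} : (comb n).Adj (Sum.inl i) (Sum.inr j) ↔ i = j :=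
  Iff.rfl

variable {m : ℕ} [(comb (m + 1)).LocallyFinite] {z c : ℂ} {f : Fin (m + 1) ⊕ Fin (m + 1) → ℂ}

theorem shift_comb_inr (f : Fin (m + 1) ⊕ Fin (m + 1) → ℂ) (i : Fin (m + 1)) :
    shift (comb (m + 1)) f (Sum.inr i) = f (Sum.inl i) := by
  have h : (comb (m + 1)).neighborFinset (Sum.inr i) = {Sum.inl i} := by
    ext (j | j)
    · rw [SimpleGraph.mem_neighborFinset, Finset.mem_singleton, Sum.inl.injEq]
      exact eq_comm
    · rw [SimpleGraph.mem_neighborFinset, Finset.mem_singleton]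
      exact iff_of_false id Sum.inr_ne_inl
  rw [shift, h, Finset.sum_singleton]

-- Padding the path with `a 0 = 0` before its first vertex and `a (m + 2)` after its last one makes
-- the equations at the two ends of the path instances of the recursion inside it.
theorem shift_comb_inl {a : ℕ → ℂ} (ha0 : a 0 = 0)
    (ha : ∀ i : Fin (m + 1), f (Sum.inl i) = a (i + 1)) (i : Fin (m + 1)) :
    shift (comb (m + 1)) f (Sum.inl i) + (if i = Fin.last m then a (m + 2) else 0) =
      a i + a (i + 2) + f (Sum.inr i) := by
  classical
  have hsplit : ∀ j : Fin (m + 1),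
      (if (comb (m + 1)).Adj (Sum.inl i) (Sum.inl j) then f (Sum.inl j) else 0) =
        (if (j : ℕ) + 1 = i then a i else 0) + if (i : ℕ) + 1 = j then a (i + 2) else 0 := by
    intro j
    rw [comb_adj_inl_inl, ha]
    split_ifs <;> grind
  have hprev : (∑ j : Fin (m + 1), if (j : ℕ) + 1 = i then a i else 0) = a i := by
    rw [Fin.sum_univ_eq_sum_range (fun j => if j + 1 = (i : ℕ) then a i else 0)]
    rcases i with ⟨_ | k, hk⟩
    · simp [ha0]
    · simp [Nat.lt_of_succ_lt hk]
  have hnext : (∑ j : Fin (m + 1), if (i : ℕ) + 1 = j then a (i + 2) else 0) +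
      (if i = Fin.last m then a (m + 2) else 0) = a (i + 2) := by
    rw [Fin.sum_univ_eq_sum_range (fun j => if (i : ℕ) + 1 = j then a (i + 2) else 0),
      Finset.sum_ite_eq]
    by_cases hi : i = Fin.last m
    · simp [hi]
    · have : (i : ℕ) + 1 < m + 1 := Nat.succ_lt_succ (Fin.lt_last_iff_ne_last.2 hi)
      simp [hi, this]
  rw [shift_eq_sum_ite, Fintype.sum_sum_type]
  simp only [hsplit, comb_adj_inl_inr, Finset.sum_add_distrib, Finset.sum_ite_eq,
    Finset.mem_univ, if_true]
  linear_combination hprev + hnext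

theorem isTruncatedEigenfunction_comb_iff {a : ℕ → ℂ} (ha0 : a 0 = 0)
    (ha : ∀ i : Fin (m + 1), f (Sum.inl i) = a (i + 1)) :
    IsTruncatedEigenfunction (comb (m + 1)) (Sum.inl (Fin.last m)) z (a (m + 2)) f ↔
      (∀ i, f (Sum.inl i) = z * f (Sum.inr i)) ∧
        ∀ i : Fin (m + 1), a i + a (i + 2) + f (Sum.inr i) = z * f (Sum.inl i) := by
  simp only [← shift_comb_inl ha0 ha]
  constructor
  · rintro ⟨hlast, hne⟩
    refine ⟨fun i => shift_comb_inr f i ▸ hne _ Sum.inr_ne_inl, fun i => ?_⟩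
    split_ifs with hi
    · exact hi ▸ hlast
    · rw [add_zero, hne _ fun h => hi (Sum.inl.inj h)]
  · rintro ⟨hinr, hinl⟩
    refine ⟨by simpa using hinl (Fin.last m), ?_⟩
    rintro (i | i) hi
    · simpa [mt (congrArg Sum.inl) hi] using hinl i
    · rw [shift_comb_inr, hinr]

theorem isTruncatedEigenfunction_comb_iff_of_ne_zero (hz : z ≠ 0) :
    IsTruncatedEigenfunction (comb (m + 1)) (Sum.inl (Fin.last m)) z c f ↔
      (∀ i, f (Sum.inl i) = z * f (Sum.inr i)) ∧ ∃ g,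
        (∀ i : Fin (m + 1), f (Sum.inl i) = g * (S ℂ i).eval (z - z⁻¹)) ∧
          c = g * (S ℂ (m + 1)).eval (z - z⁻¹) := by
  constructor
  · intro hf
    let a : ℕ → ℂ
      | 0 => 0
      | k + 1 => if hk : k < m + 1 then f (Sum.inl ⟨k, hk⟩) else c
    have ha : ∀ i : Fin (m + 1), f (Sum.inl i) = a (i + 1) := fun i => by
      simp [a, i.is_le.not_gt]
    have hlast : c = a (m + 2) := by simp [a]
    obtain ⟨hinr, hinl⟩ := (isTruncatedEigenfunction_comb_iff rfl ha).1 (hlast ▸ hf)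
    have hrec : ∀ k < m + 1, a k + a (k + 2) = (z - z⁻¹) * a (k + 1) := by
      intro k hk
      have h := hinl ⟨k, hk⟩
      have hinr' : f (Sum.inr ⟨k, hk⟩) = z⁻¹ * f (Sum.inl ⟨k, hk⟩) :=
        (eq_inv_mul_iff_mul_eq₀ hz).2 (hinr _).symm
      rw [hinr', ha] at h
      linear_combination h
    have hS := fun k hk => (eq_mul_eval_S_of_recursion (k := k) rfl hrec hk).2
    refine ⟨hinr, a 1, fun i => (ha i).trans (hS i i.is_lt.le), ?_⟩
    exact_mod_cast hlast.trans (hS (m + 1) le_rfl)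
  · rintro ⟨hinr, g, hg, rfl⟩
    let a : ℕ → ℂ := fun k => g * (S ℂ (k - 1)).eval (z - z⁻¹)
    have ha : ∀ i : Fin (m + 1), f (Sum.inl i) = a (i + 1) := fun i => by simp [a, hg]
    have hlast : a (m + 2) = g * (S ℂ (m + 1)).eval (z - z⁻¹) := by
      simp only [a, Nat.cast_add, Nat.cast_ofNat, add_sub_assoc]
      rfl
    rw [← hlast]
    refine (isTruncatedEigenfunction_comb_iff (by simp [a]) ha).2 ⟨hinr, fun i => ?_⟩
    have hS := eval_S_add_two (z - z⁻¹) (i - 1)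
    simp only [a, hg, Nat.cast_add, Nat.cast_ofNat]
    rw [sub_add_cancel, sub_add_eq_add_sub] at hS
    have hinr' : f (Sum.inr i) = z⁻¹ * f (Sum.inl i) := (eq_inv_mul_iff_mul_eq₀ hz).2 (hinr i).symm
    rw [hS, hinr', hg]
    ring

theorem eq_zero_of_isTruncatedEigenfunction_comb_zero
    (hf : IsTruncatedEigenfunction (comb (m + 1)) (Sum.inl (Fin.last m)) z 0 f)
    (hf0 : f (Sum.inl (Fin.last m)) = 0) : f = 0 := by
  have hinl : ∀ i, f (Sum.inl i) = z * f (Sum.inr i) := fun i =>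
    (shift_comb_inr f i).symm.trans (hf.2 _ Sum.inr_ne_inl)
  obtain rfl | hz := eq_or_ne z 0
  · simp only [zero_mul] at hinl
    have h := isTruncatedEigenfunction_comb_iff (a := 0) rfl hinl |>.1 hf
    ext (i | i)
    · exact hinl i
    · simpa using h.2 i
  · obtain ⟨-, g, hg, hlast⟩ := (isTruncatedEigenfunction_comb_iff_of_ne_zero hz).1 hf
    have hg0 : g = 0 := by
      by_contra hne
      refine eval_S_add_one_ne_zero (μ := z - z⁻¹) (k := m) ?_ ?_
      · exact (mul_eq_zero.1 ((hg _).symm.trans hf0)).resolve_left hne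
      · exact (mul_eq_zero.1 hlast.symm).resolve_left hne
    have hinl0 : ∀ i, f (Sum.inl i) = 0 := fun i => by rw [hg, hg0, zero_mul]
    ext (i | i)
    · exact hinl0 i
    · exact (mul_eq_zero.1 ((hinl i).symm.trans (hinl0 i))).resolve_left hz

theorem exists_isTruncatedEigenfunction_comb_iff (hz : z ≠ 0) :
    (∃ f, f (Sum.inl (Fin.last m)) = 1 ∧
      IsTruncatedEigenfunction (comb (m + 1)) (Sum.inl (Fin.last m)) z c f) ↔
      (S ℂ (m + 1)).eval (z - z⁻¹) = c * (S ℂ m).eval (z - z⁻¹) := by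
  simp only [isTruncatedEigenfunction_comb_iff_of_ne_zero hz]
  constructor
  · rintro ⟨f, hf0, -, g, hg, rfl⟩
    have h : g * (S ℂ m).eval (z - z⁻¹) = 1 := (hg (Fin.last m)).symm.trans hf0
    linear_combination -(S ℂ (m + 1)).eval (z - z⁻¹) * h
  · intro h
    have hm : (S ℂ m).eval (z - z⁻¹) ≠ 0 := fun hm =>
      eval_S_add_one_ne_zero hm (by rw [h, hm, mul_zero])
    set g := ((S ℂ m).eval (z - z⁻¹))⁻¹
    refine ⟨Sum.elim (fun i => g * (S ℂ i).eval (z - z⁻¹))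
      (fun i => z⁻¹ * (g * (S ℂ i).eval (z - z⁻¹))), ?_, fun i => ?_, g, fun i => rfl, ?_⟩
    · exact inv_mul_cancel₀ hm
    · exact (mul_inv_cancel_left₀ hz _).symm
    · rw [h, mul_left_comm, inv_mul_cancel₀ hm, mul_one]

theorem sq_add_one_ne_zero {b : ℂ} (hb : ‖b‖ < 1) : b ^ 2 + 1 ≠ 0 := by
  intro h
  have hsq : ‖b‖ ^ 2 = 1 := by
    rw [← norm_pow, eq_neg_of_add_eq_zero_left h, norm_neg, norm_one]
  exact (pow_lt_one₀ (norm_nonneg b) hb two_ne_zero).ne hsq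

theorem eval_combPoly_eq_zero_iff {b : ℂ} (hb0 : b ≠ 0) (hb : ‖b‖ < 1) :
    (combPoly (m + 1)).eval b = 0 ↔ ∃ f, f (Sum.inl (Fin.last m)) = 1 ∧
      IsTruncatedEigenfunction (comb (m + 1)) (Sum.inl (Fin.last m)) (b + 1 / b) b f := by
  have hb2 := sq_add_one_ne_zero hb
  have hdiv : b + 1 / b = (b ^ 2 + 1) / b := by field_simp
  have hz : b + 1 / b ≠ 0 := hdiv ▸ div_ne_zero hb2 hb0
  have hμ : (b + 1 / b - (b + 1 / b)⁻¹) * (b * (b ^ 2 + 1)) = b ^ 4 + b ^ 2 + 1 := by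
    rw [hdiv, inv_div]
    field_simp
    ring
  rw [exists_isTruncatedEigenfunction_comb_iff hz, eval_combPoly hμ, mul_eq_zero,
    or_iff_right (pow_ne_zero _ (mul_ne_zero hb0 hb2)), sub_eq_zero]

theorem finiteSystemEigenvalues_comb :
    finiteSystemEigenvalues (comb (m + 1)) (Sum.inl (Fin.last m)) = combEigenvalues (m + 1) := by
  ext z
  constructor
  · rintro (⟨f, hf, hf0, hfz⟩ | ⟨b, hb0, hb, rfl, hf⟩)
    · exact absurd (eq_zero_of_isTruncatedEigenfunction_comb_zero
        (isTruncatedEigenfunction_zero_iff.2 hfz) hf0) hf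
    · exact ⟨b, hb, (eval_combPoly_eq_zero_iff hb0 hb).2 hf, rfl⟩
  · rintro ⟨b, hb, hroot, rfl⟩
    have hb0 : b ≠ 0 := by
      rintro rfl
      exact one_ne_zero ((eval_combPoly_zero m).symm.trans hroot)
    exact Or.inr ⟨b, hb0, hb, rfl, (eval_combPoly_eq_zero_iff hb0 hb).1 hroot⟩

end Comb

/-! ### The kite -/

section KiteRoots

open Set

theorem existsUnique_pow_add_two_mul_sq_sub_one_eq_zero {N : ℕ} (hN : N ≠ 0) :
    ∃! x : ℝ, x ∈ Ioo 0 1 ∧ x ^ N + 2 * x ^ 2 - 1 = 0 := by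
  have hcont : ContinuousOn (fun x : ℝ => x ^ N + 2 * x ^ 2 - 1) (Icc 0 1) := by fun_prop
  have hmono : StrictMonoOn (fun x : ℝ => x ^ N + 2 * x ^ 2 - 1) (Ici 0) := by
    intro x hx y _ hxy
    have hpow : x ^ N ≤ y ^ N := pow_le_pow_left₀ hx hxy.le N
    have hsq : x ^ 2 < y ^ 2 := pow_lt_pow_left₀ hxy hx two_ne_zero
    simp only
    linarith
  obtain ⟨x, hx, hx0⟩ : (0 : ℝ) ∈ (fun x : ℝ => x ^ N + 2 * x ^ 2 - 1) '' Ioo 0 1 :=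
    intermediate_value_Ioo zero_le_one hcont ⟨by simp [hN], by norm_num⟩
  exact ⟨x, ⟨hx, hx0⟩, fun y hy => hmono.injOn hy.1.1.le hx.1.le (hy.2.trans hx0.symm)⟩

-- The equation says that the strictly convex function `y ^ (N - 2) + y ^ (-2)` takes the value `2`,
-- which it also does at `y = 1`.
theorem eq_of_neg_pow_add_two_mul_sq_sub_one_eq_zero {N : ℕ} (hN : 2 ≤ N) {x y : ℝ}
    (hx : x ∈ Ioo 0 1) (hy : y ∈ Ioo 0 1) (hx0 : -x ^ N + 2 * x ^ 2 - 1 = 0)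
    (hy0 : -y ^ N + 2 * y ^ 2 - 1 = 0) : x = y := by
  obtain ⟨M, rfl⟩ := Nat.exists_eq_add_of_le' hN
  have hconv : StrictConvexOn ℝ (Ioi 0) fun t : ℝ => t ^ M + t ^ (-2 : ℤ) :=
    ((convexOn_pow M).subset Ioi_subset_Ici_self (convex_Ioi 0)).add_strictConvexOn
      (strictConvexOn_zpow (by norm_num) (by norm_num))
  have hvalue : ∀ t : ℝ, 0 < t → -t ^ (M + 2) + 2 * t ^ 2 - 1 = 0 → t ^ M + t ^ (-2 : ℤ) = 2 := by
    intro t ht h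
    rw [zpow_neg, zpow_ofNat]
    field_simp
    linear_combination -h
  have hnot_lt : ∀ s t : ℝ, 0 < s → t < 1 → -s ^ (M + 2) + 2 * s ^ 2 - 1 = 0 →
      -t ^ (M + 2) + 2 * t ^ 2 - 1 = 0 → ¬s < t := by
    intro s t hs ht hs0 ht0 hst
    have hlt := hconv.lt_on_openSegment (Set.mem_Ioi.2 hs) (Set.mem_Ioi.2 one_pos)
      (hst.trans ht).ne
      (by rw [openSegment_eq_Ioo (hst.trans ht)]; exact ⟨hst, ht⟩)
    simp only [hvalue s hs hs0, hvalue t (hs.trans hst) ht0, one_pow, one_zpow] at hlt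
    norm_num at hlt
  exact le_antisymm (not_lt.1 (hnot_lt y x hy.1 hx.2 hy0 hx0))
    (not_lt.1 (hnot_lt x y hx.1 hy.2 hx0 hy0))

theorem existsUnique_neg_pow_add_two_mul_sq_sub_one_eq_zero {N : ℕ} (hN : 5 ≤ N) :
    ∃! y : ℝ, y ∈ Ioo 0 1 ∧ -y ^ N + 2 * y ^ 2 - 1 = 0 := by
  have hcont : ContinuousOn (fun y : ℝ => -y ^ N + 2 * y ^ 2 - 1) (Icc 0 (9 / 10)) := by fun_prop
  have hpos : 0 < -(9 / 10 : ℝ) ^ N + 2 * (9 / 10) ^ 2 - 1 := by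
    have hpow : (9 / 10 : ℝ) ^ N ≤ (9 / 10) ^ 5 :=
      pow_le_pow_of_le_one (by norm_num) (by norm_num) hN
    norm_num at hpow ⊢
    linarith
  obtain ⟨y, hy, hy0⟩ : (0 : ℝ) ∈ (fun y : ℝ => -y ^ N + 2 * y ^ 2 - 1) '' Ioo 0 (9 / 10) :=
    intermediate_value_Ioo (by norm_num) hcont ⟨by simp [zero_pow (by omega : N ≠ 0)], hpos⟩
  have hy1 : y ∈ Ioo (0 : ℝ) 1 := ⟨hy.1, hy.2.trans (by norm_num)⟩
  exact ⟨y, ⟨hy1, hy0⟩, fun t ht =>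
    eq_of_neg_pow_add_two_mul_sq_sub_one_eq_zero (by omega) ht.1 hy1 ht.2 hy0⟩

theorem existsUnique_neg_kite_root {N : ℕ} (hN : 4 ≤ N) :
    ∃! x : ℝ, x ∈ Ioo (-1) 0 ∧ x ^ N + 2 * x ^ 2 - 1 = 0 := by
  have hrefl : ∃! y : ℝ, y ∈ Ioo 0 1 ∧ (-y) ^ N + 2 * (-y) ^ 2 - 1 = 0 := by
    rcases N.even_or_odd with he | ho
    · simp only [he.neg_pow, neg_sq]
      exact existsUnique_pow_add_two_mul_sq_sub_one_eq_zero (by omega)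
    · simp only [ho.neg_pow, neg_sq]
      refine existsUnique_neg_pow_add_two_mul_sq_sub_one_eq_zero ?_
      rcases ho with ⟨k, rfl⟩
      omega
  obtain ⟨y, ⟨hy, hy0⟩, huniq⟩ := hrefl
  refine ⟨-y, ⟨⟨neg_lt_neg hy.2, neg_lt_zero.2 hy.1⟩, hy0⟩, fun x hx => ?_⟩
  refine neg_eq_iff_eq_neg.1 (huniq (-x) ⟨⟨neg_pos.2 hx.1.2, neg_lt.1 hx.1.1⟩, ?_⟩)
  rw [neg_neg]
  exact hx.2

theorem exists_kite_roots {N : ℕ} (hN : 4 ≤ N) :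
    ∃ x₁ ∈ Ioo (0 : ℝ) 1, ∃ x₂ ∈ Ioo (-1 : ℝ) 0,
      {x : ℝ | x ∈ Ioo (-1) 1 ∧ x ^ N + 2 * x ^ 2 - 1 = 0} = {x₁, x₂} := by
  obtain ⟨x₁, ⟨hx₁, hroot₁⟩, huniq₁⟩ :=
    existsUnique_pow_add_two_mul_sq_sub_one_eq_zero (by omega : N ≠ 0)
  obtain ⟨x₂, ⟨hx₂, hroot₂⟩, huniq₂⟩ := existsUnique_neg_kite_root hN
  refine ⟨x₁, hx₁, x₂, hx₂, Subset.antisymm ?_ ?_⟩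
  · rintro x ⟨hx, hroot⟩
    rcases lt_trichotomy x 0 with hneg | rfl | hpos
    · exact Or.inr (huniq₂ x ⟨⟨hx.1, hneg⟩, hroot⟩)
    · simp [zero_pow (by omega : N ≠ 0)] at hroot
    · exact Or.inl (huniq₁ x ⟨⟨hpos, hx.2⟩, hroot⟩)
  · rintro x (rfl | rfl)
    · exact ⟨⟨neg_one_lt_zero.trans hx₁.1, hx₁.2⟩, hroot₁⟩
    · exact ⟨⟨hx₂.1, hx₂.2.trans one_pos⟩, hroot₂⟩

end KiteRoots

section RootsOfUnity

variable {n : ℕ}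

theorem exp_pow_add_inv_exp_pow (n j : ℕ) :
    Complex.exp (2 * Real.pi * Complex.I / (n + 1 : ℕ)) ^ j +
      (Complex.exp (2 * Real.pi * Complex.I / (n + 1 : ℕ)) ^ j)⁻¹ =
        ((2 * Real.cos (2 * Real.pi * j / (n + 1)) : ℝ) : ℂ) := by
  have h : Complex.exp (2 * Real.pi * Complex.I / (n + 1 : ℕ)) ^ j =
      Complex.exp (((2 * Real.pi * j / (n + 1) : ℝ) : ℂ) * Complex.I) := by
    rw [← Complex.exp_nat_mul]
    congr 1
    push_cast
    ring
  rw [h, ← Complex.exp_neg, ← neg_mul, ← Complex.two_cos, Complex.ofReal_mul, Complex.ofReal_cos,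
    Complex.ofReal_ofNat]

theorem mem_kiteCosines_iff {z : ℂ} :
    z ∈ kiteCosines n ↔ ∃ b : ℂ, b ^ (n + 1) = 1 ∧ b ^ 2 ≠ 1 ∧ z = b + b⁻¹ := by
  have hprim := Complex.isPrimitiveRoot_exp (n + 1) n.succ_ne_zero
  set ζ := Complex.exp (2 * Real.pi * Complex.I / (n + 1 : ℕ))
  constructor
  · rintro ⟨j, hj1, hj2, rfl⟩
    refine ⟨ζ ^ j, ?_, fun h => ?_, (exp_pow_add_inv_exp_pow n j).symm⟩
    · rw [pow_right_comm, hprim.pow_eq_one, one_pow]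
    · rw [← pow_mul, hprim.pow_eq_one_iff_dvd] at h
      have := Nat.le_of_dvd (by omega) h
      omega
  · rintro ⟨b, hb, hb2, rfl⟩
    obtain ⟨j, hj, rfl⟩ := hprim.eq_pow_of_pow_eq_one hb
    have hj0 : j ≠ 0 := by
      rintro rfl
      simp at hb2
    have hj2 : j * 2 ≠ n + 1 := fun h => hb2 (by rw [← pow_mul, h, hprim.pow_eq_one])
    obtain h | h := le_or_gt j (n / 2)
    · exact ⟨j, by omega, h, exp_pow_add_inv_exp_pow n j⟩
    · have hinv : ζ ^ (n + 1 - j) = (ζ ^ j)⁻¹ := by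
        refine eq_inv_of_mul_eq_one_left ?_
        rw [← pow_add, Nat.sub_add_cancel hj.le, hprim.pow_eq_one]
      refine ⟨n + 1 - j, by omega, by omega, ?_⟩
      rw [← exp_pow_add_inv_exp_pow, hinv, inv_inv, add_comm]

theorem eq_zero_of_recursion {z : ℂ} {a : ℕ → ℂ} (ha : ∀ k, a k + a (k + 2) = z * a (k + 1))
    (ha0 : a 0 = 0) (ha1 : a 1 = 0) (k : ℕ) : a k = 0 := by
  induction k using Nat.twoStepInduction with
  | zero => exact ha0
  | one => exact ha1
  | more k ih ih' => simpa [ih, ih'] using ha k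

theorem pow_eq_one_and_sq_ne_one_of_recursion {b : ℂ} (hb0 : b ≠ 0) {a : ℕ → ℂ}
    (ha : ∀ k, a k + a (k + 2) = (b + b⁻¹) * a (k + 1)) {N : ℕ} (hN : N ≠ 0) (ha0 : a 0 = 0)
    (ha1 : a 1 ≠ 0) (haN : a N = 0) (haN1 : a (N + 1) = a 1) : b ^ N = 1 ∧ b ^ 2 ≠ 1 := by
  have hstep : ∀ k, b ^ k * (a (k + 1) - b * a k) = a 1 := fun k => by
    simpa [ha0] using pow_mul_sub_eq_of_recursion hb0 (fun j _ => ha j) le_rfl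
  constructor
  · have h := hstep N
    rw [haN, haN1, mul_zero, sub_zero] at h
    exact (mul_eq_right₀ ha1).1 h
  · intro hb2
    have hlinear : ∀ k : ℕ, a k = k * b ^ (k + 1) * a 1 := by
      intro k
      induction k with
      | zero => simp [ha0]
      | succ k ih =>
        have hsq : b ^ k * b ^ k = 1 := by rw [← mul_pow, ← sq, hb2, one_pow]
        push_cast
        linear_combination b ^ k * hstep k - (a (k + 1) - b * a k) * hsq + b * ih
          - b ^ k * a 1 * hb2
    have hzero := hlinear N
    simp [haN, ha1, hb0, hN] at hzero

end RootsOfUnity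

section Cycle

open SimpleGraph
open scoped Fin.NatCast Fin.CommRing

variable {n : ℕ}

theorem natCast_add_one_eq_zero : ((n + 1 : ℕ) : Fin (n + 1)) = 0 := Fin.natCast_self _

theorem natCast_add_two_eq_one : ((n + 2 : ℕ) : Fin (n + 1)) = (1 : ℕ) := by
  rw [show n + 2 = (n + 1) + 1 from rfl, Nat.cast_add, natCast_add_one_eq_zero, zero_add]

variable [(cycleGraph (n + 1)).LocallyFinite] {z b c : ℂ} {f : Fin (n + 1) → ℂ}

theorem shift_cycleGraph (hn : 2 ≤ n) (f : Fin (n + 1) → ℂ) (k : ℕ) :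
    shift (cycleGraph (n + 1)) f (k + 1 : ℕ) = f k + f (k + 2 : ℕ) := by
  obtain ⟨m, rfl⟩ := Nat.exists_eq_add_of_le' hn
  have hneighbor : (cycleGraph (m + 3)).neighborFinset ((k + 1 : ℕ) : Fin (m + 3)) =
      {(k : Fin (m + 3)), ((k + 2 : ℕ) : Fin (m + 3))} := by
    ext w
    rw [mem_neighborFinset, Finset.mem_insert, Finset.mem_singleton, cycleGraph_adj,
      sub_eq_iff_eq_add', sub_eq_iff_eq_add']
    push_cast
    rw [add_left_inj, eq_comm, add_assoc (k : Fin (m + 3)), one_add_one_eq_two]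
  have hne : (k : Fin (m + 3)) ≠ ((k + 2 : ℕ) : Fin (m + 3)) := by
    push_cast
    rw [Ne, left_eq_add]
    exact ne_of_beq_false rfl
  rw [shift, hneighbor, Finset.sum_pair hne]

theorem isTruncatedEigenfunction_cycleGraph_iff (hn : 2 ≤ n) :
    IsTruncatedEigenfunction (cycleGraph (n + 1)) 0 z c f ↔
      f n + f (1 : ℕ) + c = z * f 0 ∧ ∀ k < n, f k + f (k + 2 : ℕ) = z * f (k + 1 : ℕ) := by
  have hzero := shift_cycleGraph hn f n
  rw [natCast_add_one_eq_zero, natCast_add_two_eq_one] at hzero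
  rw [IsTruncatedEigenfunction, hzero]
  refine and_congr_right fun _ => ⟨fun h k hk => ?_, fun h v hv => ?_⟩
  · have hk0 : ((k + 1 : ℕ) : Fin (n + 1)) ≠ 0 := fun h0 =>
      Nat.not_dvd_of_pos_of_lt k.succ_pos (Nat.succ_lt_succ hk) (Fin.natCast_eq_zero.1 h0)
    rw [← shift_cycleGraph hn, h _ hk0]
  · have hv0 : 1 ≤ v.val := Nat.one_le_iff_ne_zero.2 (Fin.val_ne_zero_iff.2 hv)
    obtain ⟨k, hk, rfl⟩ : ∃ k < n, v = (k + 1 : ℕ) :=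
      ⟨v - 1, by omega, by rw [Nat.sub_add_cancel hv0, Fin.cast_val_eq_self]⟩
    rw [shift_cycleGraph hn, h k hk]

theorem mem_kiteCosines_of_eigenfunction_cycleGraph (hn : 2 ≤ n) (hf : f ≠ 0) (hf0 : f 0 = 0)
    (hfz : ∀ v, shift (cycleGraph (n + 1)) f v = z * f v) : z ∈ kiteCosines n := by
  obtain ⟨b, hb0, -, rfl⟩ := exists_eq_add_inv z
  set a : ℕ → ℂ := fun k => f k with ha
  have ha0 : a 0 = 0 := by simp [ha, hf0]
  have hrec : ∀ k, a k + a (k + 2) = (b + b⁻¹) * a (k + 1) := fun k =>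
    (shift_cycleGraph hn f k).symm.trans (hfz _)
  have ha1 : a 1 ≠ 0 := by
    intro ha1
    refine hf (funext fun v => ?_)
    simpa [ha] using eq_zero_of_recursion hrec ha0 ha1 v
  have hlast : a (n + 1) = 0 := by rw [← hf0, ← natCast_add_one_eq_zero]
  have hfirst : a (n + 2) = a 1 := by simp only [ha, natCast_add_two_eq_one]
  obtain ⟨hpow, hb2⟩ :=
    pow_eq_one_and_sq_ne_one_of_recursion hb0 hrec n.succ_ne_zero ha0 ha1 hlast hfirst
  exact mem_kiteCosines_iff.2 ⟨b, hpow, hb2, rfl⟩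

theorem exists_eigenfunction_cycleGraph (hn : 2 ≤ n) (hz : z ∈ kiteCosines n) :
    ∃ f : Fin (n + 1) → ℂ, f ≠ 0 ∧ f 0 = 0 ∧ ∀ v, shift (cycleGraph (n + 1)) f v = z * f v := by
  obtain ⟨b, hb, hb2, rfl⟩ := mem_kiteCosines_iff.1 hz
  have hb0 : b ≠ 0 := by
    rintro rfl
    simp at hb
  set f : Fin (n + 1) → ℂ := fun v => b ^ v.val - b⁻¹ ^ v.val with hf
  have hcast : ∀ k : ℕ, f k = b ^ k - b⁻¹ ^ k := by
    intro k
    simp only [hf, Fin.val_natCast]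
    rw [← pow_eq_pow_mod k hb, ← pow_eq_pow_mod k (by rw [inv_pow, hb, inv_one])]
  refine ⟨f, fun h => hb2 ?_, by simp [hf], fun v => ?_⟩
  · have hcast1 := hcast 1
    rw [h, Pi.zero_apply, pow_one, pow_one, eq_comm, sub_eq_zero] at hcast1
    rw [sq, ← mul_inv_cancel₀ hb0, ← hcast1]
  · obtain ⟨k, rfl⟩ : ∃ k : ℕ, v = (k + 1 : ℕ) := by
      refine ⟨v + n, ?_⟩
      rw [add_assoc, Nat.cast_add, natCast_add_one_eq_zero, add_zero, Fin.cast_val_eq_self]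
    simp only [shift_cycleGraph hn, hcast, inv_pow]
    field_simp
    ring

theorem kite_root_of_isTruncatedEigenfunction_cycleGraph (hn : 2 ≤ n) (hb0 : b ≠ 0)
    (hf0 : f 0 = 1) (hf : IsTruncatedEigenfunction (cycleGraph (n + 1)) 0 (b + b⁻¹) b f) :
    b ^ (n + 1) + 2 * b ^ 2 - 1 = 0 := by
  obtain ⟨hzero, hrec⟩ := (isTruncatedEigenfunction_cycleGraph_iff hn).1 hf
  set a : ℕ → ℂ := fun k => f k with ha
  have ha0 : a 0 = 1 := by simp [ha, hf0]
  have hlast : a (n + 1) = 1 := by rw [← hf0, ← natCast_add_one_eq_zero]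
  have hsum : b * (a 1 + a n) = 1 := by
    rw [hf0] at hzero
    linear_combination b * hzero + mul_inv_cancel₀ hb0
  have hb := pow_mul_sub_eq_of_recursion (a := a) hb0 hrec le_rfl
  have hinv := pow_mul_sub_eq_of_recursion (a := a) (inv_ne_zero hb0)
    (fun k hk => by rw [inv_inv, add_comm b⁻¹]; exact hrec k hk) le_rfl
  rw [ha0, hlast] at hb hinv
  have hinv' : b - a n = b ^ n * (b * a 1 - 1) := by
    rw [inv_pow] at hinv
    field_simp at hinv
    linear_combination hinv
  linear_combination b * hb + b * hinv' + (1 + b ^ (n + 1)) * hsum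

theorem exists_isTruncatedEigenfunction_cycleGraph (hn : 2 ≤ n) (hb0 : b ≠ 0) (hb : ‖b‖ < 1)
    (hroot : b ^ (n + 1) + 2 * b ^ 2 - 1 = 0) :
    ∃ f, f 0 = 1 ∧ IsTruncatedEigenfunction (cycleGraph (n + 1)) 0 (b + b⁻¹) b f := by
  have hd : 1 + b ^ (n + 1) ≠ 0 := by
    intro h
    have hnorm : ‖b‖ ^ (n + 1) = 1 := by
      rw [← norm_pow, eq_neg_of_add_eq_zero_right h, norm_neg, norm_one]
    exact (pow_lt_one₀ (norm_nonneg b) hb n.succ_ne_zero).ne hnorm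
  set f : Fin (n + 1) → ℂ := fun v => (b ^ v.val + b ^ (n + 1 - v.val)) / (1 + b ^ (n + 1)) with hf
  have hcast : ∀ k ≤ n + 1, f (k : ℕ) = (b ^ k + b ^ (n + 1 - k)) / (1 + b ^ (n + 1)) := by
    intro k hk
    obtain hk | rfl := hk.lt_or_eq
    · simp only [hf, Fin.val_natCast, Nat.mod_eq_of_lt hk]
    · simp [hf, add_comm]
  have hf0 : f 0 = 1 := by simp [hf, hd]
  refine ⟨f, hf0, (isTruncatedEigenfunction_cycleGraph_iff hn).2 ⟨?_, fun k hk => ?_⟩⟩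
  · rw [hf0, hcast n (by omega), hcast 1 (by omega), Nat.add_sub_cancel_left, Nat.add_sub_cancel]
    field_simp
    linear_combination hroot
  · obtain ⟨t, rfl⟩ : ∃ t, n = k + 1 + t := Nat.exists_eq_add_of_le hk
    rw [hcast k (by omega), hcast (k + 1) (by omega), hcast (k + 2) (by omega),
      show k + 1 + t + 1 - k = t + 2 by omega, show k + 1 + t + 1 - (k + 1) = t + 1 by omega,
      show k + 1 + t + 1 - (k + 2) = t by omega]
    field_simp
    ring

theorem finiteSystemEigenvalues_cycleGraph (hn : 2 ≤ n) :
    finiteSystemEigenvalues (cycleGraph (n + 1)) 0 = kiteCosines n ∪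
      (fun x : ℝ => ((x + 1 / x : ℝ) : ℂ)) ''
        {x : ℝ | x ∈ Set.Ioo (-1) 1 ∧ x ^ (n + 1) + 2 * x ^ 2 - 1 = 0} := by
  ext z
  refine or_congr ⟨?_, exists_eigenfunction_cycleGraph hn⟩ ⟨?_, ?_⟩
  · rintro ⟨f, hf, hf0, hfz⟩
    exact mem_kiteCosines_of_eigenfunction_cycleGraph hn hf hf0 hfz
  · rintro ⟨b, hb0, hb, rfl, f, hf0, hf⟩
    rw [one_div] at hf
    have him : b.im = 0 := im_eq_zero_of_isTruncatedEigenfunction hb0 hb hf0 hf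
    have hroot := kite_root_of_isTruncatedEigenfunction_cycleGraph hn hb0 hf0 hf
    lift b to ℝ using him
    rw [Complex.norm_real, Real.norm_eq_abs, abs_lt] at hb
    exact ⟨b, ⟨hb, by exact_mod_cast hroot⟩, by push_cast; rfl⟩
  · rintro ⟨x, ⟨hx, hroot⟩, rfl⟩
    have hx0 : (x : ℂ) ≠ 0 := by
      rintro h
      simp [Complex.ofReal_eq_zero.1 h] at hroot
    have hb : ‖(x : ℂ)‖ < 1 := by rwa [Complex.norm_real, Real.norm_eq_abs, abs_lt]
    have hz : ((x + 1 / x : ℝ) : ℂ) = (x : ℂ) + 1 / x := by push_cast; rfl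
    beta_reduce
    rw [hz]
    refine ⟨x, hx0, hb, rfl, ?_⟩
    rw [one_div]
    exact exists_isTruncatedEigenfunction_cycleGraph hn hx0 hb (by exact_mod_cast hroot)

end Cycle

section Triangle

theorem kiteCosines_two : kiteCosines 2 = {-1} := by
  have hcos : (2 * Real.cos (2 * Real.pi * (1 : ℕ) / ((2 : ℕ) + 1)) : ℝ) = -1 := by
    rw [show 2 * Real.pi * (1 : ℕ) / ((2 : ℕ) + 1) = Real.pi - Real.pi / 3 by push_cast; ring,
      Real.cos_pi_sub, Real.cos_pi_div_three]
    norm_num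
  ext z
  rw [Set.mem_singleton_iff]
  constructor
  · rintro ⟨j, hj1, hj2, rfl⟩
    obtain rfl : j = 1 := by omega
    rw [hcos, Complex.ofReal_neg, Complex.ofReal_one]
  · rintro rfl
    refine ⟨1, le_rfl, le_rfl, ?_⟩
    rw [hcos, Complex.ofReal_neg, Complex.ofReal_one]

theorem triangle_roots : {x : ℝ | x ∈ Set.Ioo (-1) 1 ∧ x ^ (2 + 1) + 2 * x ^ 2 - 1 = 0} =
    {(√5 - 1) / 2} := by
  have hsq : √5 ^ 2 = 5 := Real.sq_sqrt (by norm_num)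
  have hlower : 2 < √5 := Real.lt_sqrt_of_sq_lt (by norm_num)
  have hupper : √5 < 3 := (Real.sqrt_lt' (by norm_num)).2 (by norm_num)
  ext x
  rw [Set.mem_ofPred_eq, Set.mem_singleton_iff]
  constructor
  · rintro ⟨hx, hroot⟩
    have hfactor : (x + 1) * (2 * x + 1 + √5) * (2 * x + 1 - √5) = 0 := by
      linear_combination 4 * hroot - (x + 1) * hsq
    have hpos : 0 < (x + 1) * (2 * x + 1 + √5) :=
      mul_pos (by linarith [hx.1]) (by linarith [hx.1])
    linarith [(mul_eq_zero.1 hfactor).resolve_left hpos.ne']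
  · rintro rfl
    refine ⟨⟨by linarith, by linarith⟩, ?_⟩
    linear_combination ((√5 - 1) / 8 + 1 / 4) * hsq

theorem finiteSystemEigenvalues_triangle [(SimpleGraph.cycleGraph (2 + 1)).LocallyFinite] :
    finiteSystemEigenvalues (SimpleGraph.cycleGraph (2 + 1)) 0 = {-1, ((√5 : ℝ) : ℂ)} := by
  have hvalue : (√5 - 1) / 2 + 1 / ((√5 - 1) / 2) = √5 := by
    have hsq : √5 ^ 2 = 5 := Real.sq_sqrt (by norm_num)
    have hne : √5 - 1 ≠ 0 := sub_ne_zero.2 (Real.lt_sqrt_of_sq_lt (by norm_num)).ne'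
    field_simp
    linear_combination -hsq
  rw [finiteSystemEigenvalues_cycleGraph le_rfl, kiteCosines_two, triangle_roots,
    Set.image_singleton, hvalue]
  rfl

end Triangle

end InfiniteTail

end

open InfiniteTail in
theorem mainTheorem12 (p : ℝ≥0∞) [Fact (1 ≤ p)] :
    -- the infinite tail
    (spectrum ℂ (tailShift p) = band ∧ essentialSpectrum (tailShift p) = band) ∧
    -- an arbitrary finite graph with an infinite tail
    (∀ (V : Type*) [Fintype V] (H : SimpleGraph V) [DecidableRel H.Adj] (v₀ : V),
      essentialSpectrum (attachTailShift H v₀ p) = band ∧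
      spectrum ℂ (attachTailShift H v₀ p) = band ∪ pointSpectrum (attachTailShift H v₀ p) ∧
      (p ≠ ∞ → pointSpectrum (attachTailShift H v₀ p) = finiteSystemEigenvalues H v₀) ∧
      spectrum ℂ (attachTailShift H v₀ p) = band ∪ finiteSystemEigenvalues H v₀) ∧
    -- the kite over the triangle
    ((p ≠ ∞ → pointSpectrum (kiteShift 2 p) = {-1, ((Real.sqrt 5 : ℝ) : ℂ)}) ∧
      spectrum ℂ (kiteShift 2 p) = band ∪ {-1, ((Real.sqrt 5 : ℝ) : ℂ)}) ∧
    -- the kite over a longer cycle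
    (∀ n : ℕ, 3 ≤ n → ∃ x₁ ∈ Set.Ioo (0 : ℝ) 1, ∃ x₂ ∈ Set.Ioo (-1 : ℝ) 0,
      {x : ℝ | x ∈ Set.Ioo (-1) 1 ∧ x ^ (n + 1) + 2 * x ^ 2 - 1 = 0} = {x₁, x₂} ∧
      (p ≠ ∞ → pointSpectrum (kiteShift n p) =
        kiteCosines n ∪ {((x₁ + 1 / x₁ : ℝ) : ℂ), ((x₂ + 1 / x₂ : ℝ) : ℂ)}) ∧
      spectrum ℂ (kiteShift n p) =
        band ∪ (kiteCosines n ∪ {((x₁ + 1 / x₁ : ℝ) : ℂ), ((x₂ + 1 / x₂ : ℝ) : ℂ)})) ∧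
    -- the fly-swatter
    (∀ n : ℕ, 2 ≤ n →
      (p ≠ ∞ → pointSpectrum (flySwatterShift n p) =
        {-1, ((flySwatterRoot n + 1 / flySwatterRoot n : ℝ) : ℂ)}) ∧
      spectrum ℂ (flySwatterShift n p) =
        band ∪ {-1, ((flySwatterRoot n + 1 / flySwatterRoot n : ℝ) : ℂ)}) ∧
    -- the comb with an infinite tail
    (∀ (n : ℕ) (hn : 2 ≤ n),
      (p ≠ ∞ → pointSpectrum (combShift n hn p) = combEigenvalues n) ∧
      spectrum ℂ (combShift n hn p) = band ∪ combEigenvalues n) := by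
  classical
  refine ⟨⟨spectrum_tailShift p, essentialSpectrum_tailShift p⟩, fun V _ H _ v₀ => ?_, ?_,
    fun n hn => ?_, fun n hn => ?_, fun n hn => ?_⟩
  · exact ⟨essentialSpectrum_attachTailShift H v₀ p,
      spectrum_attachTailShift_eq_union_pointSpectrum H v₀ p,
      pointSpectrum_attachTailShift H v₀ p, spectrum_attachTailShift H v₀ p⟩
  · rw [← finiteSystemEigenvalues_triangle]
    exact ⟨pointSpectrum_attachTailShift _ _ p, spectrum_attachTailShift _ _ p⟩
  · obtain ⟨x₁, hx₁, x₂, hx₂, hroots⟩ := exists_kite_roots (by omega : 4 ≤ n + 1)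
    have hkite := finiteSystemEigenvalues_cycleGraph (by omega : 2 ≤ n)
    rw [hroots, Set.image_pair] at hkite
    refine ⟨x₁, hx₁, x₂, hx₂, hroots, ?_⟩
    rw [← hkite]
    exact ⟨pointSpectrum_attachTailShift _ _ p, spectrum_attachTailShift _ _ p⟩
  · rw [← finiteSystemEigenvalues_top hn (Fintype.card_fin _) 0]
    exact ⟨pointSpectrum_attachTailShift _ _ p, spectrum_attachTailShift _ _ p⟩
  · obtain ⟨m, rfl⟩ := Nat.exists_eq_add_of_le' (one_le_two.trans hn)
    rw [← finiteSystemEigenvalues_comb]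
    exact ⟨pointSpectrum_attachTailShift _ _ p, spectrum_attachTailShift _ _ p⟩
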